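/- Let $n_A,n_B\ge 0$ and $k\ge 1$ be integers with $n_B>(k+1)n_A$, put $N_A=2^{n_A}$, $N_B=2^{n_B}$ (so that $N_B>N_A^{k+1}$), and let $\mathcal H_{AB}=\mathcal H_A\otimes\mathcal H_B$ be the space of $n_A+n_B$ qubits. Let $\Phi$ be a random pure state (unit vector) of $\mathcal H_{AB}$ whose distribution is an $\varepsilon'$-approximate state $2k$-design, i.e. $$\Big\|\mathbb E_\Phi(|\Phi\rangle\langle\Phi|)^{\otimes l}-\mathbb E_{\Psi\sim\mathrm{Haar}}(|\Psi\rangle\langle\Psi|)^{\otimes l}\Big\|_1\le\varepsilon'\qquad\text{for all } l\le 2k,$$ where $\|\cdot\|_1$ is the trace norm, and suppose $\varepsilon'\le c/(N_B^{2k}N_A)$ for a constant $c>0$. For $z\in\{0,1\}^{n_B}$ let $|\tilde\Phi_z\rangle=(I_A\otimes\langle z|_B)|\Phi\rangle$, $q_z=\langle\tilde\Phi_z|\tilde\Phi_z\rangle$, $|\Phi_z\rangle=|\tilde\Phi_z\rangle/\sqrt{q_z}$. Call the projected ensemble $\mathcal E=\{q_z,|\Phi_z\rangle\}$ an $\varepsilon$-approximate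 state $k$-design if $$\Big\|\sum_{z}q_z(|\Phi_z\rangle\langle\Phi_z|)^{\otimes k}-\mathbb E_{\Psi\sim\mathrm{Haar}(\mathcal H_A)}(|\Psi\rangle\langle\Psi|)^{\otimes k}\Big\|_1\le\varepsilon .$$ Then the following hold. (1) There is a constant $C>0$ depending only on $c$ such that for every $\alpha\in(0,\tfrac12)$, with probability at least $1-C/N_A^{1/2-\alpha}$ over $\Phi$, the projected ensemble $\mathcal E$ is an $\varepsilon$-approximate state $k$-design for some $\varepsilon<k/N_A^{\alpha}$. (2) In particular, if $k$ is polynomially bounded in $n_A$, say $k\le D\,n_A^{d}$, then there are constants $C,\gamma>0$ depending only on $c,D,d$ such that, with probability at least $1-C2^{-\gamma n_A}$, $\mathcal E$ is a $C2^{-\gamma n_A}$-approximate state $k$-design. -/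

import Mathlib

open MeasureTheory

noncomputable section

namespace ProjectedDesign

/-- Bit strings of length `n`: the labels of the computational basis of `n` qubits. -/
abbrev Bits (n : ℕ) : Type := Fin n → Bool

/-- The Hilbert space with orthonormal (computational) basis labelled by `ι`. For
`ι = Bits nA × Bits nB` this is `H_A ⊗ H_B`, written in the product basis `|x⟩ ⊗ |z⟩`. -/
abbrev Hilb (ι : Type) [Fintype ι] : Type := EuclideanSpace ℂ ι

/-- Pure states: unit vectors. -/
abbrev PureState (ι : Type) [Fintype ι] : Type := Metric.sphere (0 : Hilb ι) 1

/-- The operator `(|ψ⟩⟨ψ|)^{⊗ k}`, as a matrix in the product basis of `H^{⊗ k}`. -/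
def ketbraPow {ι : Type} [Fintype ι] (ψ : Hilb ι) (k : ℕ) :
    Matrix (Fin k → ι) (Fin k → ι) ℂ :=
  Matrix.of fun x y => ∏ i, ψ (x i) * star (ψ (y i))

/-- The trace norm (Schatten 1-norm): the sum of the singular values, i.e. of the square roots of
the eigenvalues of `Mᴴ M`. -/
def traceNorm {m : Type} [Fintype m] [DecidableEq m] (M : Matrix m m ℂ) : ℝ :=
  ∑ i, Real.sqrt ((Matrix.isHermitian_conjTranspose_mul_self M).eigenvalues i)

/-- The `k`-th moment `E_{Φ ∼ μ} (|Φ⟩⟨Φ|)^{⊗ k}` of a distribution of pure states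
(the expectation is taken entry by entry). -/
def moment {ι : Type} [Fintype ι] (μ : Measure (PureState ι)) (k : ℕ) :
    Matrix (Fin k → ι) (Fin k → ι) ℂ :=
  Matrix.of fun x y => ∫ Φ : PureState ι, ketbraPow (Φ : Hilb ι) k x y ∂μ

/-- The Haar distribution of pure states: the normalized surface measure of the unit sphere. -/
def haarState (ι : Type) [Fintype ι] : Measure (PureState ι) :=
  ((volume : Measure (Hilb ι)).toSphere Set.univ)⁻¹ • (volume : Measure (Hilb ι)).toSphere

/-- `μ` is an `ε`-approximate state `t`-design (in trace norm): each of its moments of order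
at most `t` is within `ε` of the corresponding Haar moment. -/
def IsApproxStateDesign {ι : Type} [Fintype ι] [DecidableEq ι]
    (μ : Measure (PureState ι)) (t : ℕ) (ε : ℝ) : Prop :=
  ∀ l : ℕ, l ≤ t → traceNorm (moment μ l - moment (haarState ι) l) ≤ ε

/-- The unnormalized post-measurement state `(I_A ⊗ ⟨z|_B) |Φ⟩` on `A`. -/
def unnormState {nA nB : ℕ} (Φ : Hilb (Bits nA × Bits nB)) (z : Bits nB) : Hilb (Bits nA) :=
  WithLp.toLp 2 fun x => Φ (x, z)

/-- The probability `q_z` of the measurement outcome `z` on `B`: the squared norm of the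
unnormalized post-measurement state. -/
def outcomeProb {nA nB : ℕ} (Φ : Hilb (Bits nA × Bits nB)) (z : Bits nB) : ℝ :=
  ‖unnormState Φ z‖ ^ 2

/-- The normalized post-measurement state `|Φ_z⟩` (the zero vector if `q_z = 0`, in which case it
carries no weight in the projected ensemble). -/
def postState {nA nB : ℕ} (Φ : Hilb (Bits nA × Bits nB)) (z : Bits nB) : Hilb (Bits nA) :=
  ((Real.sqrt (outcomeProb Φ z))⁻¹ : ℂ) • unnormState Φ z

/-- The `k`-th moment `∑_z q_z (|Φ_z⟩⟨Φ_z|)^{⊗ k}` of the projected ensemble `{q_z, |Φ_z⟩}`. -/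
def projectedMoment {nA nB : ℕ} (Φ : Hilb (Bits nA × Bits nB)) (k : ℕ) :
    Matrix (Fin k → Bits nA) (Fin k → Bits nA) ℂ :=
  ∑ z : Bits nB, (outcomeProb Φ z : ℂ) • ketbraPow (postState Φ z) k

/-- The projected ensemble of `Φ` on `A` is an `ε`-approximate state `k`-design: its `k`-th moment
is within `ε`, in trace norm, of the `k`-th moment of the Haar distribution on `A`. -/
def IsApproxProjectedDesign {nA nB : ℕ} (Φ : Hilb (Bits nA × Bits nB)) (k : ℕ) (ε : ℝ) : Prop :=
  traceNorm (projectedMoment Φ k - moment (haarState (Bits nA)) k) ≤ ε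

end ProjectedDesign

end

/-!
Write `a = N_A`, `b = N_B`, `q_z` for the outcome probabilities and `K_z = (|Φ̃_z⟩⟨Φ̃_z|)^{⊗ k}`.
The moment `∑ z, q_z ^ (1 - k) K_z` of the projected ensemble is a rational function of the state,
whereas a design only controls polynomials. It is therefore compared with `b ^ (k - 1) ∑ z, K_z`,
and that matrix with the Haar moment, which is the maximally mixed state of the symmetric
subspace, of dimension `d = a (a + 1) ⋯ (a + k - 1) / k!` (`moment_haarState`).

* The first difference has trace norm at most `∑ z, q_z |1 - (b q_z) ^ (k - 1)|`. As the `q_z` sum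
  to one, the square of this is at most `∑ z, q_z (1 - (b q_z) ^ (k - 1)) ^ 2`, a polynomial of
  degree `2k - 1` in the state and its conjugate (`sq_traceNorm_projectedMoment_sub_le`).
* The second difference is supported on the symmetric subspace, so its squared trace norm is at
  most `d` times its squared Frobenius norm, a polynomial of degree `2k`
  (`sq_traceNorm_sub_moment_haarState_le`).

Twice the sum of the two polynomials, `errBound`, dominates the squared distance. Its Haar average
is a combination of ratios of rising factorials (`integral_monom_haarState`, obtained by
integrating monomials against a Gaussian in polar coordinates). It is at most a constant times
`k ^ 2 / a` as long as `k ^ 2 ≤ 4 a`; here the diagonal terms of the Frobenius norm contribute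
`d / b ≤ 1 / a` because `b > a ^ (k + 1)`.

Passing from Haar states to an approximate design must not lose a factor `d`. The overlaps
`|⟨Φ̃_z|Φ̃_z'⟩| ^ (2k)`, summed over all `z` and `z'`, are the expectation of one partial
permutation operator on `2k` copies (`overlapMoment_eq`). It has operator norm one, so by duality
of the trace norm the whole sum changes by at most `ε'` (`norm_integral_sum_sub_le`).

Markov's inequality for `errBound` then gives the probability bound. When `k > 2 a ^ α` the
claimed accuracy is worse than `2`, which bounds the distance of any two density matrices;
otherwise `k ^ 2 ≤ 4 a` (`le_measureReal_traceNorm_lt`). The second part is the case `α = 1 / 4`.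
-/

noncomputable section

namespace ProjectedDesign

/-! ### Duality for the trace norm -/

section TraceNorm

open Matrix
open scoped Matrix.Norms.L2Operator ComplexOrder

variable {m : Type} [Fintype m]

theorem sum_norm_sq_eq_trace_mul_self {X : Matrix m m ℂ} (hX : Xᴴ = X) :
    ((∑ i, ∑ j, ‖X i j‖ ^ 2 : ℝ) : ℂ) = (X * X).trace := by
  simp only [trace, diag_apply, Matrix.mul_apply, Complex.ofReal_sum]
  refine Finset.sum_congr rfl fun i _ => Finset.sum_congr rfl fun j _ => ?_
  have hij : X j i = star (X i j) := by rw [← conjTranspose_apply, hX]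
  rw [hij, Complex.ofReal_pow, ← Complex.mul_conj']
  rfl

variable [DecidableEq m]

theorem sum_norm_sq_mulVec_le {O : Matrix m m ℂ} (hO : ‖O‖ ≤ 1) (v : m → ℂ) :
    ∑ i, ‖(O *ᵥ v) i‖ ^ 2 ≤ ∑ i, ‖v i‖ ^ 2 := by
  have h := Matrix.l2_opNorm_mulVec O (WithLp.toLp 2 v)
  have h2 := h.trans (mul_le_of_le_one_left (norm_nonneg _) hO)
  have h3 := pow_le_pow_left₀ (norm_nonneg _) h2 2
  simpa [EuclideanSpace.norm_sq_eq] using h3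

theorem norm_sum_mul_le_sqrt_mul_sqrt {κ : Type*} (s : Finset κ) (f g : κ → ℂ) :
    ‖∑ i ∈ s, f i * g i‖ ≤ √(∑ i ∈ s, ‖f i‖ ^ 2) * √(∑ i ∈ s, ‖g i‖ ^ 2) := by
  refine (norm_sum_le _ _).trans ?_
  simp only [norm_mul]
  exact Real.sum_mul_le_sqrt_mul_sqrt s _ _

/-- The trace norm is attained by a matrix of operator norm at most one: the adjoint of the partial
isometry in the polar decomposition of `M`. -/
theorem exists_trace_mul_eq_traceNorm (M : Matrix m m ℂ) :
    ∃ O : Matrix m m ℂ, ‖O‖ ≤ 1 ∧ (O * M).trace = traceNorm M := by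
  set hA := Matrix.isHermitian_conjTranspose_mul_self M with hA_def
  set lam : m → ℝ := hA.eigenvalues with hlam
  have hpos : ∀ i, 0 ≤ lam i := (Matrix.posSemidef_conjTranspose_mul_self M).eigenvalues_nonneg
  set U : Matrix m m ℂ := hA.eigenvectorUnitary.1 with hU
  have hUU : Uᴴ * U = 1 := Unitary.coe_star_mul_self hA.eigenvectorUnitary
  have hspec : Mᴴ * M = U * diagonal (fun i => (lam i : ℂ)) * Uᴴ := by
    have := hA.spectral_theorem
    rw [Unitary.conjStarAlgAut_apply] at this
    exact this
  set E : Matrix m m ℂ := diagonal fun i => (((√(lam i))⁻¹ : ℝ) : ℂ) with hE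
  have hEH : Eᴴ = E := by
    rw [hE, diagonal_conjTranspose]
    congr 1
    ext i
    simp
  -- with `|M| = (Mᴴ M)^{1/2}`, this is `|M|⁻¹ Mᴴ`; since `0⁻¹ = 0`, it is a pseudo-inverse
  refine ⟨U * E * Uᴴ * Mᴴ, ?_, ?_⟩
  · have key : (U * E * Uᴴ * Mᴴ) * (U * E * Uᴴ * Mᴴ)ᴴ
        = U * (diagonal fun i => (((if lam i = 0 then 0 else 1 : ℝ)) : ℂ)) * Uᴴ := by
      simp only [conjTranspose_mul, conjTranspose_conjTranspose, hEH]
      calc _ = U * E * Uᴴ * (Mᴴ * M) * (U * E * Uᴴ) := by simp only [Matrix.mul_assoc]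
        _ = U * (E * (Uᴴ * U) * diagonal (fun i => (lam i : ℂ)) * (Uᴴ * U) * E) * Uᴴ := by
          rw [hspec]; simp only [Matrix.mul_assoc]
        _ = _ := by
          rw [hUU, Matrix.mul_one, Matrix.mul_one, hE, diagonal_mul_diagonal, diagonal_mul_diagonal]
          congr 3
          ext i
          rw [← Complex.ofReal_mul, ← Complex.ofReal_mul, Complex.ofReal_inj]
          split_ifs with h
          · simp [h]
          · have h0 : 0 < √(lam i) := Real.sqrt_pos.2 (lt_of_le_of_ne (hpos i) (Ne.symm h))
            rw [mul_comm, ← mul_assoc, ← mul_inv, Real.mul_self_sqrt (hpos i), inv_mul_cancel₀ h]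
    have hUn : ‖U‖ ≤ 1 := by
      have : ‖Uᴴ * U‖ = ‖U‖ * ‖U‖ := Matrix.l2_opNorm_conjTranspose_mul_self U
      rw [hUU] at this
      have h1 : ‖(1 : Matrix m m ℂ)‖ ≤ 1 := by
        rw [← diagonal_one, Matrix.l2_opNorm_diagonal]
        exact (pi_norm_le_iff_of_nonneg zero_le_one).2 fun i => by simp
      nlinarith [norm_nonneg U]
    have hsq : ‖U * E * Uᴴ * Mᴴ‖ * ‖U * E * Uᴴ * Mᴴ‖ ≤ 1 := by
      have h1 := Matrix.l2_opNorm_conjTranspose_mul_self (U * E * Uᴴ * Mᴴ)ᴴ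
      rw [conjTranspose_conjTranspose, key, Matrix.l2_opNorm_conjTranspose] at h1
      rw [← h1]
      refine (Matrix.l2_opNorm_mul _ _).trans ?_
      rw [Matrix.l2_opNorm_conjTranspose]
      refine mul_le_one₀ ((Matrix.l2_opNorm_mul _ _).trans ?_) (norm_nonneg _) hUn
      refine mul_le_one₀ hUn (norm_nonneg _) ?_
      rw [Matrix.l2_opNorm_diagonal]
      refine (pi_norm_le_iff_of_nonneg zero_le_one).2 fun i => ?_
      split_ifs <;> simp
    nlinarith [norm_nonneg (U * E * Uᴴ * Mᴴ)]
  · have : (U * E * Uᴴ * Mᴴ) * M = U * (E * diagonal (fun i => (lam i : ℂ))) * Uᴴ := by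
      calc _ = U * E * Uᴴ * (Mᴴ * M) := by simp only [Matrix.mul_assoc]
        _ = U * E * (Uᴴ * U) * diagonal (fun i => (lam i : ℂ)) * Uᴴ := by
          rw [hspec]; simp only [Matrix.mul_assoc]
        _ = _ := by rw [hUU, Matrix.mul_one]; simp only [Matrix.mul_assoc]
    rw [this, trace_mul_comm, ← Matrix.mul_assoc, hUU, Matrix.one_mul, hE, diagonal_mul_diagonal,
      trace_diagonal, traceNorm, Complex.ofReal_sum]
    refine Finset.sum_congr rfl fun i _ => ?_
    rw [← Complex.ofReal_mul, Complex.ofReal_inj]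
    change (√(lam i))⁻¹ * lam i = √(lam i)
    rw [inv_mul_eq_div, Real.div_sqrt]

/-- Duality between the trace norm and the operator norm. -/
theorem norm_trace_mul_le_traceNorm {O : Matrix m m ℂ} (hO : ‖O‖ ≤ 1) (M : Matrix m m ℂ) :
    ‖(O * M).trace‖ ≤ traceNorm M := by
  set hA := Matrix.isHermitian_conjTranspose_mul_self M with hA_def
  set lam : m → ℝ := hA.eigenvalues with hlam
  set U : Matrix m m ℂ := hA.eigenvectorUnitary.1 with hU
  have hUU : Uᴴ * U = 1 := Unitary.coe_star_mul_self hA.eigenvectorUnitary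
  have hUU' : U * Uᴴ = 1 := Unitary.coe_mul_star_self hA.eigenvectorUnitary
  have hspec : Mᴴ * M = U * diagonal (fun i => (lam i : ℂ)) * Uᴴ := by
    have := hA.spectral_theorem
    rw [Unitary.conjStarAlgAut_apply] at this
    exact this
  -- in an eigenbasis of `Mᴴ M` the columns of `M` have norms equal to the singular values
  have hcolU : ∀ i, ∑ j, ‖U j i‖ ^ 2 = 1 := by
    intro i
    have h := congrFun (congrFun hUU i) i
    rw [Matrix.mul_apply, one_apply_eq] at h
    have : ((∑ j, ‖U j i‖ ^ 2 : ℝ) : ℂ) = 1 := by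
      rw [← h, Complex.ofReal_sum]
      refine Finset.sum_congr rfl fun j _ => ?_
      rw [conjTranspose_apply, Complex.ofReal_pow, ← Complex.conj_mul']
      rfl
    exact_mod_cast this
  have hcolB : ∀ i, ∑ j, ‖(M * U) j i‖ ^ 2 = lam i := by
    intro i
    have h : (M * U)ᴴ * (M * U) = diagonal (fun i => (lam i : ℂ)) := by
      rw [conjTranspose_mul]
      calc _ = Uᴴ * (Mᴴ * M) * U := by simp only [Matrix.mul_assoc]
        _ = (Uᴴ * U) * diagonal (fun i => (lam i : ℂ)) * (Uᴴ * U) := by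
          rw [hspec]; simp only [Matrix.mul_assoc]
        _ = _ := by rw [hUU, Matrix.mul_one, Matrix.one_mul]
    have h := congrFun (congrFun h i) i
    rw [Matrix.mul_apply, diagonal_apply_eq] at h
    have : ((∑ j, ‖(M * U) j i‖ ^ 2 : ℝ) : ℂ) = lam i := by
      rw [← h, Complex.ofReal_sum]
      refine Finset.sum_congr rfl fun j _ => ?_
      rw [conjTranspose_apply, Complex.ofReal_pow, ← Complex.conj_mul']
      rfl
    exact_mod_cast this
  have htr : (O * M).trace = ∑ i, ∑ j, (Uᴴ * O) i j * (M * U) j i := by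
    calc (O * M).trace = (O * M * (U * Uᴴ)).trace := by rw [hUU', Matrix.mul_one]
      _ = ((Uᴴ * O) * (M * U)).trace := by
        rw [← Matrix.mul_assoc, trace_mul_comm]; simp only [Matrix.mul_assoc]
      _ = _ := by simp only [trace, diag_apply, Matrix.mul_apply (M := Uᴴ * O)]
  rw [htr, traceNorm]
  refine (norm_sum_le _ _).trans (Finset.sum_le_sum fun i _ => ?_)
  refine (norm_sum_mul_le_sqrt_mul_sqrt _ _ _).trans ?_
  rw [hcolB]
  refine mul_le_of_le_one_left (Real.sqrt_nonneg _) (Real.sqrt_le_one.2 ?_)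
  have hrow : ∀ j, ‖(Uᴴ * O) i j‖ = ‖(Oᴴ *ᵥ fun l => U l i) j‖ := by
    intro j
    rw [← norm_star]
    congr 1
    rw [Matrix.mul_apply, star_sum, mulVec, dotProduct]
    exact Finset.sum_congr rfl fun l _ => by simp [mul_comm]
  simp only [hrow]
  exact (sum_norm_sq_mulVec_le (by rwa [Matrix.l2_opNorm_conjTranspose]) _).trans (hcolU i).le

theorem traceNorm_nonneg (M : Matrix m m ℂ) : 0 ≤ traceNorm M :=
  Finset.sum_nonneg fun _ _ => Real.sqrt_nonneg _

theorem traceNorm_le_of_forall {M : Matrix m m ℂ} {r : ℝ}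
    (h : ∀ O : Matrix m m ℂ, ‖O‖ ≤ 1 → ‖(O * M).trace‖ ≤ r) : traceNorm M ≤ r := by
  obtain ⟨O, hO, hM⟩ := exists_trace_mul_eq_traceNorm M
  have := h O hO
  rwa [hM, Complex.norm_real, Real.norm_of_nonneg (traceNorm_nonneg M)] at this

theorem traceNorm_add_le (M M' : Matrix m m ℂ) :
    traceNorm (M + M') ≤ traceNorm M + traceNorm M' :=
  traceNorm_le_of_forall fun O hO => by
    rw [Matrix.mul_add, trace_add]
    exact (norm_add_le _ _).trans
      (add_le_add (norm_trace_mul_le_traceNorm hO M) (norm_trace_mul_le_traceNorm hO M'))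

theorem traceNorm_sub_le (M M' : Matrix m m ℂ) :
    traceNorm (M - M') ≤ traceNorm M + traceNorm M' :=
  traceNorm_le_of_forall fun O hO => by
    rw [Matrix.mul_sub, trace_sub]
    exact (norm_sub_le _ _).trans
      (add_le_add (norm_trace_mul_le_traceNorm hO M) (norm_trace_mul_le_traceNorm hO M'))

/-- A matrix `X` supported on the range of the orthogonal projection `P` has trace norm at most
`√(rank P)` times its Frobenius norm. -/
theorem traceNorm_le_sqrt_mul_sqrt {X P : Matrix m m ℂ} {d : ℝ} (hP : P * P = P) (hPH : Pᴴ = P)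
    (hd : P.trace = d) (hX : X * P = X) :
    traceNorm X ≤ √d * √(∑ i, ∑ j, ‖X i j‖ ^ 2) := by
  refine traceNorm_le_of_forall fun O hO => ?_
  have htr : (O * X).trace = ∑ p : m × m, (P * O) p.1 p.2 * X p.2 p.1 := by
    rw [Fintype.sum_prod_type, ← hX, ← Matrix.mul_assoc, trace_mul_comm, ← Matrix.mul_assoc, hX]
    simp only [trace, diag_apply, Matrix.mul_apply (M := P * O)]
  rw [htr]
  refine (norm_sum_mul_le_sqrt_mul_sqrt _ _ _).trans ?_
  refine mul_le_mul (Real.sqrt_le_sqrt ?_) (le_of_eq ?_) (Real.sqrt_nonneg _) (Real.sqrt_nonneg _)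
  · rw [Fintype.sum_prod_type]
    have hrow : ∀ i j, ‖(P * O) i j‖ = ‖(Oᴴ *ᵥ fun l => star (P i l)) j‖ := by
      intro i j
      rw [← norm_star]
      congr 1
      rw [Matrix.mul_apply, star_sum, mulVec, dotProduct]
      exact Finset.sum_congr rfl fun l _ => by simp [mul_comm]
    simp only [hrow]
    refine (Finset.sum_le_sum fun i _ =>
      sum_norm_sq_mulVec_le (by rwa [Matrix.l2_opNorm_conjTranspose]) _).trans (le_of_eq ?_)
    have h := sum_norm_sq_eq_trace_mul_self hPH
    rw [hP, hd] at h
    simp only [norm_star]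
    exact_mod_cast h
  · rw [Fintype.sum_prod_type, Finset.sum_comm]

/-- A linear combination of the rank-one matrices `|v⟩⟨v|` has trace norm at most the sum of the
trace norms of its terms. -/
theorem traceNorm_sum_smul_vecMulVec_le {κ : Type*} [Fintype κ] (a : κ → ℝ) (v : κ → m → ℂ) :
    traceNorm (∑ z, (a z : ℂ) • vecMulVec (v z) (star (v z)))
      ≤ ∑ z, |a z| * ∑ i, ‖v z i‖ ^ 2 := by
  refine traceNorm_le_of_forall fun O hO => ?_
  rw [Matrix.mul_sum, trace_sum]
  refine (norm_sum_le _ _).trans (Finset.sum_le_sum fun z _ => ?_)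
  rw [Matrix.mul_smul, trace_smul, norm_smul, Complex.norm_real, Real.norm_eq_abs]
  refine mul_le_mul_of_nonneg_left ?_ (abs_nonneg _)
  rw [trace_mul_comm, vecMulVec_mul, trace_vecMulVec, dotProduct_comm, ← dotProduct_mulVec,
    dotProduct]
  refine (norm_sum_mul_le_sqrt_mul_sqrt _ _ _).trans ?_
  have h := sum_norm_sq_mulVec_le hO (v z)
  have h0 : 0 ≤ ∑ i, ‖v z i‖ ^ 2 := by positivity
  calc _ ≤ √(∑ i, ‖v z i‖ ^ 2) * √(∑ i, ‖v z i‖ ^ 2) := by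
        simp only [Pi.star_apply, norm_star]
        gcongr
    _ = _ := Real.mul_self_sqrt h0

/-- Pairing a matrix with a partial permutation matrix costs at most its trace norm. -/
theorem norm_sum_filter_apply_le_traceNorm (σ : Equiv.Perm m) (s : Finset m)
    (M : Matrix m m ℂ) : ‖∑ x ∈ s, M x (σ x)‖ ≤ traceNorm M := by
  set O : Matrix m m ℂ := Matrix.of fun y x => if x ∈ s ∧ y = σ x then 1 else 0 with hO
  have h1 : ‖O‖ ≤ 1 := by
    have hOO : Oᴴ * O = diagonal fun x => if x ∈ s then 1 else 0 := by
      ext x x'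
      rw [Matrix.mul_apply, Finset.sum_eq_single (σ x)]
      · simp only [hO, conjTranspose_apply, of_apply, diagonal_apply, EmbeddingLike.apply_eq_iff_eq]
        by_cases hx : x ∈ s <;> by_cases hxx : x = x' <;> simp_all
      · intro b _ hb
        simp [hO, hb]
      · simp
    have h2 := Matrix.l2_opNorm_conjTranspose_mul_self O
    rw [hOO, Matrix.l2_opNorm_diagonal] at h2
    have h3 : ‖fun x => if x ∈ s then (1 : ℂ) else 0‖ ≤ 1 :=
      (pi_norm_le_iff_of_nonneg zero_le_one).2 fun i => by split_ifs <;> simp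
    nlinarith [norm_nonneg O]
  refine le_of_eq_of_le ?_ (norm_trace_mul_le_traceNorm h1 M)
  congr 1
  rw [trace_mul_comm]
  simp [trace, Matrix.mul_apply, hO, ite_and]

end TraceNorm

/-! ### Moments of the Haar distribution from Gaussian integrals -/

section HaarMoments

open scoped ComplexConjugate Real

/-- Rotation invariance kills `z ^ n * conj z ^ m` for `n ≠ m`; for `n = m` the integral is a Gamma
value. -/
theorem integral_pow_mul_conj_pow_mul_exp (n m : ℕ) :
    ∫ z : ℂ, z ^ n * conj z ^ m * (Real.exp (-‖z‖ ^ 2) : ℂ)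
      = if n = m then (π : ℂ) * n.factorial else 0 := by
  split_ifs with h
  · subst h
    have h1 := Complex.integral_rpow_mul_exp_neg_rpow (p := 2) (q := 2 * n) (by norm_num)
      (by linarith [(Nat.cast_nonneg n : (0 : ℝ) ≤ n)])
    have h2 : ((2 * n + 2) / 2 : ℝ) = n + 1 := by ring
    rw [h2, Real.Gamma_nat_eq_factorial] at h1
    have h3 : ∀ z : ℂ, z ^ n * conj z ^ n * (Real.exp (-‖z‖ ^ 2) : ℂ)
        = ((‖z‖ ^ (2 * n : ℝ) * Real.exp (-‖z‖ ^ (2 : ℝ)) : ℝ) : ℂ) := by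
      intro z
      have : (‖z‖ ^ (2 * n : ℝ) : ℝ) = (‖z‖ ^ 2) ^ n := by
        rw [← pow_mul, ← Real.rpow_natCast]; simp
      rw [← mul_pow, Complex.mul_conj', this, Real.rpow_two]
      push_cast
      rfl
    simp only [h3]
    rw [integral_complex_ofReal, h1]
    push_cast
    ring
  · set I := ∫ z : ℂ, z ^ n * conj z ^ m * (Real.exp (-‖z‖ ^ 2) : ℂ) with hI
    -- rotation by this angle multiplies the integrand by `-1`
    set θ : ℝ := π / ((n : ℝ) - m) with hθ
    have hnm : (n : ℝ) - m ≠ 0 := sub_ne_zero.2 (by exact_mod_cast h)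
    have h1 : I = ∫ z : ℂ, (rotation (Circle.exp θ) z) ^ n * conj (rotation (Circle.exp θ) z) ^ m
        * (Real.exp (-‖rotation (Circle.exp θ) z‖ ^ 2) : ℂ) :=
      ((rotation (Circle.exp θ)).measurePreserving.integral_comp
        (rotation (Circle.exp θ)).toHomeomorph.measurableEmbedding _).symm
    have hc : (Circle.exp θ : ℂ) ^ n * conj (Circle.exp θ : ℂ) ^ m = -1 := by
      rw [Circle.coe_exp, ← Complex.exp_conj, ← Complex.exp_nat_mul, ← Complex.exp_nat_mul,
        ← Complex.exp_add, ← Complex.exp_pi_mul_I]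
      congr 1
      simp only [map_mul, Complex.conj_ofReal, Complex.conj_I]
      have : (π : ℂ) = ((n : ℂ) - m) * θ := by
        rw [hθ]
        push_cast
        have : ((n : ℂ) - m) ≠ 0 := by exact_mod_cast hnm
        field_simp
      rw [this]
      ring
    have h2 : I = -I := by
      conv_lhs => rw [h1]
      rw [hI, ← integral_neg]
      congr 1
      ext z
      rw [LinearIsometryEquiv.norm_map, rotation_apply, map_mul, mul_pow, mul_pow]
      linear_combination (z ^ n * conj z ^ m * (Real.exp (-‖z‖ ^ 2) : ℂ)) * hc
    exact self_eq_neg.1 h2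

variable {ι : Type} [Fintype ι]

/-- The monomial `∏ a, v_a ^ n_a * conj v_a ^ m_a`. -/
def monom (n m : ι → ℕ) (v : Hilb ι) : ℂ := ∏ a, v a ^ n a * conj (v a) ^ m a

/-- Lebesgue measure on `ℂ^ι` is, up to a scale, a product measure, so the Gaussian integral of a
monomial factors. -/
theorem exists_integral_monom_mul_exp (ι : Type) [Fintype ι] :
    ∃ K : ℂ, K ≠ 0 ∧ ∀ n m : ι → ℕ,
      ∫ v : Hilb ι, monom n m v * (Real.exp (-‖v‖ ^ 2) : ℂ)
        = K * if n = m then ((∏ a, (n a).factorial : ℕ) : ℂ) else 0 := by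
  set e : (ι → ℂ) ≃L[ℝ] Hilb ι :=
    (PiLp.continuousLinearEquiv 2 ℝ fun _ : ι => ℂ).symm with he
  have hmap : (Measure.map e volume).IsAddHaarMeasure := e.isAddHaarMeasure_map volume
  set κ := Measure.addHaarScalarFactor (volume : Measure (Hilb ι)) (Measure.map e volume) with hκ
  have hκ0 : 0 < κ := Measure.addHaarScalarFactor_pos_of_isAddHaarMeasure _ _
  have hvol : (volume : Measure (Hilb ι)) = κ • Measure.map e volume :=
    Measure.isAddLeftInvariant_eq_smul _ _
  refine ⟨(κ : ℝ) * (π : ℂ) ^ Fintype.card ι, ?_, fun n m => ?_⟩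
  · refine mul_ne_zero ?_ (pow_ne_zero _ (by exact_mod_cast Real.pi_ne_zero))
    exact_mod_cast hκ0.ne'
  · rw [hvol, integral_smul_nnreal_measure,
      (show MeasurableEmbedding e from e.toHomeomorph.measurableEmbedding).integral_map]
    have h1 : ∀ w : ι → ℂ, monom n m (e w) * (Real.exp (-‖e w‖ ^ 2) : ℂ)
        = ∏ a, (w a ^ n a * conj (w a) ^ m a * (Real.exp (-‖w a‖ ^ 2) : ℂ)) := by
      intro w
      rw [Finset.prod_mul_distrib, EuclideanSpace.norm_sq_eq, ← Finset.sum_neg_distrib,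
        Real.exp_sum, Complex.ofReal_prod]
      rfl
    have h2 : ∫ w : ι → ℂ, monom n m (e w) * (Real.exp (-‖e w‖ ^ 2) : ℂ)
        = ∏ a, ∫ z : ℂ, z ^ n a * conj z ^ m a * (Real.exp (-‖z‖ ^ 2) : ℂ) := by
      simp only [h1]
      exact integral_fintype_prod_eq_prod (𝕜 := ℂ)
        (fun a (z : ℂ) => z ^ n a * conj z ^ m a * (Real.exp (-‖z‖ ^ 2) : ℂ))
    refine (congrArg (κ • ·) h2).trans ?_
    simp only [integral_pow_mul_conj_pow_mul_exp]
    rw [NNReal.smul_def, Complex.real_smul, mul_assoc]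
    congr 1
    split_ifs with h
    · subst h
      simp [Finset.prod_mul_distrib]
    · obtain ⟨a, ha⟩ := Function.ne_iff.1 h
      rw [mul_zero]
      exact Finset.prod_eq_zero (Finset.mem_univ a) (if_neg ha)

/-- Integration in polar coordinates of a homogeneous function against a Gaussian. -/
theorem integral_mul_exp_eq_integral_toSphere [Nonempty ι] (l : ℕ) (f : Hilb ι → ℂ)
    (hf : ∀ (r : ℝ) (u : Hilb ι), f (r • u) = (r : ℂ) ^ (2 * l) * f u) :
    ∫ v : Hilb ι, f v * (Real.exp (-‖v‖ ^ 2) : ℂ)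
      = (∫ u : PureState ι, f u ∂(volume : Measure (Hilb ι)).toSphere)
        * (((Fintype.card ι + l - 1).factorial : ℂ) / 2) := by
  set μ : Measure (Hilb ι) := volume with hμ
  have hdim : Module.finrank ℝ (Hilb ι) = 2 * Fintype.card ι := by
    rw [← Module.finrank_mul_finrank ℝ ℂ (Hilb ι), Complex.finrank_real_complex,
      finrank_euclideanSpace]
  have hN : 0 < Fintype.card ι := Fintype.card_pos
  calc ∫ v : Hilb ι, f v * (Real.exp (-‖v‖ ^ 2) : ℂ) ∂μ
      = ∫ x : ({(0)}ᶜ : Set (Hilb ι)), f x.1 * (Real.exp (-‖x.1‖ ^ 2) : ℂ) ∂(μ.comap (↑)) := by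
        rw [integral_subtype_comap (measurableSet_singleton _).compl
          fun v : Hilb ι ↦ f v * (Real.exp (-‖v‖ ^ 2) : ℂ), restrict_compl_singleton]
    _ = ∫ p, f p.1.1 * ((p.2.1 : ℂ) ^ (2 * l) * (Real.exp (-p.2.1 ^ 2) : ℂ))
          ∂μ.toSphere.prod (.volumeIoiPow (Module.finrank ℝ (Hilb ι) - 1)) := by
        rw [← μ.measurePreserving_homeomorphUnitSphereProd.integral_comp
          (Homeomorph.measurableEmbedding _)]
        congr 1
        ext x
        have hx : ‖x.1‖ ≠ 0 := norm_ne_zero_iff.2 x.2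
        have h1 : f x.1 = (‖x.1‖ : ℂ) ^ (2 * l) * f (‖x.1‖⁻¹ • x.1) := by
          rw [← hf, smul_inv_smul₀ hx]
        simp only [homeomorphUnitSphereProd_apply_fst_coe, homeomorphUnitSphereProd_apply_snd_coe]
        rw [h1]
        ring
    _ = (∫ u : PureState ι, f u ∂μ.toSphere) * ∫ r : Set.Ioi (0 : ℝ),
          ((r.1 : ℂ) ^ (2 * l) * (Real.exp (-r.1 ^ 2) : ℂ))
          ∂.volumeIoiPow (Module.finrank ℝ (Hilb ι) - 1) :=
        integral_prod_mul (L := ℂ) (fun u : PureState ι => f u.1) fun r : Set.Ioi (0 : ℝ) =>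
          ((r.1 : ℂ) ^ (2 * l) * (Real.exp (-r.1 ^ 2) : ℂ))
    _ = _ := by
        congr 1
        simp only [Measure.volumeIoiPow, ENNReal.ofReal]
        rw [integral_withDensity_eq_integral_smul
            (measurable_subtype_coe.pow_const _).real_toNNReal,
          integral_subtype_comap measurableSet_Ioi fun a : ℝ ↦
            Real.toNNReal (a ^ (Module.finrank ℝ (Hilb ι) - 1)) •
              ((a : ℂ) ^ (2 * l) * (Real.exp (-a ^ 2) : ℂ))]
        have h1 := _root_.integral_rpow_mul_exp_neg_rpow (p := 2)
          (q := ((2 * (Fintype.card ι + l) - 1 : ℕ) : ℝ)) (by norm_num)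
          (by linarith [(Nat.cast_nonneg (2 * (Fintype.card ι + l) - 1) : (0 : ℝ) ≤ _)])
        have h2 : ((((2 * (Fintype.card ι + l) - 1 : ℕ) : ℝ) + 1) / 2 : ℝ)
            = ((Fintype.card ι + l - 1 : ℕ) : ℝ) + 1 := by
          have e1 : ((2 * (Fintype.card ι + l) - 1 : ℕ) : ℝ) + 1
              = 2 * (((Fintype.card ι + l - 1 : ℕ) : ℝ) + 1) := by
            norm_cast; omega
          rw [e1]; ring
        rw [h2, Real.Gamma_nat_eq_factorial] at h1
        have h3 : ((((Fintype.card ι + l - 1).factorial : ℂ) / 2))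
            = ((1 / 2 * ((Fintype.card ι + l - 1).factorial : ℝ) : ℝ) : ℂ) := by
          push_cast; ring
        rw [h3, ← h1, ← integral_complex_ofReal]
        refine setIntegral_congr_fun measurableSet_Ioi fun r hr => ?_
        have hr : (0 : ℝ) ≤ r := le_of_lt hr
        have e2 : 2 * (Fintype.card ι + l) - 1 = 2 * Fintype.card ι - 1 + 2 * l := by omega
        simp only [NNReal.smul_def, Real.coe_toNNReal _ (pow_nonneg hr _), hdim,
          Real.rpow_natCast, Real.rpow_two, Complex.real_smul]
        rw [e2]
        push_cast
        ring

theorem monom_smul {n m : ι → ℕ} {l : ℕ} (hn : ∑ a, n a = l) (hm : ∑ a, m a = l) (r : ℝ)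
    (u : Hilb ι) : monom n m (r • u) = (r : ℂ) ^ (2 * l) * monom n m u := by
  have h : ∀ a, ((r • u) a) ^ n a * conj ((r • u) a) ^ m a
      = (r : ℂ) ^ n a * (r : ℂ) ^ m a * (u a ^ n a * conj (u a) ^ m a) := by
    intro a
    simp only [PiLp.smul_apply, Complex.real_smul, map_mul, Complex.conj_ofReal]
    ring
  unfold monom
  simp only [h]
  rw [Finset.prod_mul_distrib, Finset.prod_mul_distrib, Finset.prod_pow_eq_pow_sum,
    Finset.prod_pow_eq_pow_sum, hn, hm, two_mul, pow_add]

instance [Nonempty ι] : IsProbabilityMeasure (haarState ι) := by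
  constructor
  rw [haarState, Measure.smul_apply, smul_eq_mul]
  have : Nontrivial (Hilb ι) := by
    refine Module.nontrivial_of_finrank_pos (R := ℂ) ?_
    rw [finrank_euclideanSpace]
    exact Fintype.card_pos
  refine ENNReal.inv_mul_cancel ?_ (measure_ne_top _ _)
  rw [Ne, Measure.measure_univ_eq_zero]
  exact Measure.toSphere_ne_zero _

/-- The moments of the Haar distribution: distinct multi-indices are orthogonal, and the `2l`-th
radial moment of the Gaussian contributes the rising factorial of the dimension. -/
theorem integral_monom_haarState [Nonempty ι] {n m : ι → ℕ} {l : ℕ} (hn : ∑ a, n a = l)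
    (hm : ∑ a, m a = l) :
    ∫ u : PureState ι, monom n m u ∂haarState ι
      = if n = m then ((∏ a, (n a).factorial : ℕ) : ℂ) / ((Fintype.card ι).ascFactorial l : ℂ)
        else 0 := by
  obtain ⟨K, hK, hG⟩ := exists_integral_monom_mul_exp ι
  set T : Measure (PureState ι) := (volume : Measure (Hilb ι)).toSphere with hT
  have hN : 0 < Fintype.card ι := Fintype.card_pos
  -- the constant monomial supplies the normalization of the surface measure
  have h0 := integral_mul_exp_eq_integral_toSphere 0 (monom (0 : ι → ℕ) 0)
    (monom_smul (by simp) (by simp))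
  have hl := integral_mul_exp_eq_integral_toSphere l (monom n m) (monom_smul hn hm)
  rw [hG] at h0 hl
  have hT1 : ∫ u : PureState ι, monom (0 : ι → ℕ) 0 u ∂T = (T.real Set.univ : ℂ) := by
    simp [monom]
  rw [hT1] at h0
  have hfac := Nat.factorial_mul_ascFactorial' (Fintype.card ι) l hN
  rw [← hfac] at hl
  simp only [if_true, Pi.zero_apply, Nat.factorial_zero, Finset.prod_const_one, Nat.cast_one,
    mul_one, add_zero] at h0
  have hF : ((Fintype.card ι - 1).factorial : ℂ) ≠ 0 := by
    exact_mod_cast Nat.factorial_ne_zero _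
  have hA : ((Fintype.card ι).ascFactorial l : ℂ) ≠ 0 := by
    exact_mod_cast (Nat.pos_of_ne_zero (by
      intro h; rw [h] at hfac
      exact (Nat.factorial_ne_zero _) (by simpa using hfac.symm))).ne'
  have hTn : (T.real Set.univ : ℂ) ≠ 0 := by
    intro h; rw [h, zero_mul] at h0; exact hK h0
  have hint : ∫ u : PureState ι, monom n m u ∂haarState ι
      = (T.real Set.univ : ℂ)⁻¹ * ∫ u : PureState ι, monom n m u ∂T := by
    rw [haarState, integral_smul_measure, ENNReal.toReal_inv, Complex.real_smul]
    push_cast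
    rfl
  rw [hint]
  push_cast at hl
  rw [h0] at hl
  split_ifs at hl ⊢ with h
  · field_simp
    have := mul_left_cancel₀ (a := ((Fintype.card ι - 1).factorial : ℂ) / 2)
      (b := (T.real Set.univ : ℂ) * ∏ a, ((n a).factorial : ℂ))
      (c := (∫ u : PureState ι, monom n m u ∂T) * (Fintype.card ι).ascFactorial l)
      (by simpa using hF) (by linear_combination hl)
    push_cast
    linear_combination -this
  · rw [mul_zero] at hl
    have : ∫ u : PureState ι, monom n m u ∂T = 0 := by
      have := hl.symm
      simp only [mul_eq_zero, div_eq_zero_iff, hF, hA] at this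
      simpa using this
    rw [this, mul_zero]

end HaarMoments

/-! ### Haar moments and the symmetric subspace -/

section SymmetricProjection

open Matrix
open scoped ComplexConjugate

variable {ι : Type} {k : ℕ}

section

variable [DecidableEq ι]

/-- The type of a string `x`: how often each letter occurs in it. -/
def mult (x : Fin k → ι) (a : ι) : ℕ := (Finset.univ.filter fun i => x i = a).card

theorem mult_comp_perm (x : Fin k → ι) (π : Equiv.Perm (Fin k)) : mult (x ∘ π) = mult x := by
  ext a
  unfold mult
  refine Finset.card_bij (fun i _ => π i) ?_ ?_ ?_
  · simp
  · simp
  · intro j hj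
    exact ⟨π.symm j, by simpa using hj, by simp⟩

theorem exists_comp_perm_eq {x y : Fin k → ι} (h : mult x = mult y) :
    ∃ π : Equiv.Perm (Fin k), x ∘ π = y := by
  have hc : ∀ a, Nonempty ({i // y i = a} ≃ {i // x i = a}) := fun a => by
    refine Fintype.card_eq.1 ?_
    rw [Fintype.card_subtype, Fintype.card_subtype]
    exact (congrFun h a).symm
  refine ⟨Equiv.ofFiberEquiv fun a => (hc a).some, ?_⟩
  ext i
  exact Equiv.ofFiberEquiv_map _ i

end

section

variable [Fintype ι]

theorem ketbraPow_conjTranspose (v : Hilb ι) : (ketbraPow v k)ᴴ = ketbraPow v k := by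
  ext x y
  simp [ketbraPow, conjTranspose_apply, mul_comm]

theorem trace_ketbraPow (v : Hilb ι) : (ketbraPow v k).trace = ((‖v‖ ^ 2) ^ k : ℝ) := by
  simp only [trace, diag_apply, ketbraPow, of_apply]
  rw [← Fintype.sum_pow (fun a => v a * star (v a)) k, EuclideanSpace.norm_sq_eq]
  push_cast
  congr 2
  ext a
  exact Complex.mul_conj' (v a)

theorem ketbraPow_eq_vecMulVec (v : Hilb ι) :
    ketbraPow v k = vecMulVec (fun x => ∏ i, v (x i)) (star fun x => ∏ i, v (x i)) := by
  ext x y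
  simp [ketbraPow, vecMulVec_apply, Finset.prod_mul_distrib]

theorem sum_norm_sq_prod (v : Hilb ι) :
    ∑ x : Fin k → ι, ‖∏ i, v (x i)‖ ^ 2 = (‖v‖ ^ 2) ^ k := by
  rw [EuclideanSpace.norm_sq_eq, Fintype.sum_pow]
  refine Finset.sum_congr rfl fun x _ => ?_
  rw [norm_prod, Finset.prod_pow]

theorem continuous_ketbraPow_apply (x y : Fin k → ι) :
    Continuous fun Φ : Hilb ι => ketbraPow Φ k x y := by
  unfold ketbraPow
  simp only [of_apply]
  fun_prop

theorem _root_.Continuous.integrable_pureState {E : Type*} [NormedAddCommGroup E]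
    {f : PureState ι → E} (hf : Continuous f)
    (μ : Measure (PureState ι)) [IsFiniteMeasure μ] : Integrable f μ :=
  hf.integrable_of_hasCompactSupport (HasCompactSupport.of_compactSpace f)

theorem integrable_ketbraPow_apply (μ : Measure (PureState ι)) [IsFiniteMeasure μ]
    (x y : Fin k → ι) : Integrable (fun Φ : PureState ι => ketbraPow Φ.1 k x y) μ :=
  ((continuous_ketbraPow_apply x y).comp continuous_subtype_val).integrable_pureState μ

theorem trace_moment (μ : Measure (PureState ι)) [IsProbabilityMeasure μ] :
    (moment μ k).trace = 1 := by
  simp only [trace, diag_apply, moment, of_apply]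
  rw [← integral_finsetSum _ fun x _ => integrable_ketbraPow_apply μ x x]
  have h : ∀ Φ : PureState ι, ∑ x, ketbraPow Φ.1 k x x = 1 := fun Φ => by
    have := trace_ketbraPow (k := k) Φ.1
    rw [norm_eq_of_mem_sphere Φ] at this
    simpa [trace] using this
  simp [h]

theorem ascFactorial_card_ne_zero (ι : Type) [Fintype ι] [Nonempty ι] (k : ℕ) :
    (Fintype.card ι).ascFactorial k ≠ 0 := by
  have := Nat.factorial_mul_ascFactorial' (Fintype.card ι) k Fintype.card_pos
  intro h
  rw [h, mul_zero] at this
  exact Nat.factorial_ne_zero _ this.symm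

/-- The dimension `N (N + 1) ⋯ (N + k - 1) / k!` of the symmetric subspace. -/
def symDim (N k : ℕ) : ℝ := (N.ascFactorial k : ℝ) / (k.factorial : ℝ)

theorem symDim_pos (ι : Type) [Fintype ι] [Nonempty ι] (k : ℕ) : 0 < symDim (Fintype.card ι) k :=
  div_pos (by exact_mod_cast Nat.pos_of_ne_zero (ascFactorial_card_ne_zero ι k))
    (by exact_mod_cast k.factorial_pos)

end

variable [Fintype ι] [DecidableEq ι]

theorem sum_mult (x : Fin k → ι) : ∑ a, mult x a = k := by
  unfold mult
  rw [← Finset.card_eq_sum_card_fiberwise (fun _ _ => Finset.mem_coe.2 (Finset.mem_univ _))]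
  simp

theorem prod_pow_mult (x : Fin k → ι) (f : ι → ℂ) : ∏ a, f a ^ mult x a = ∏ i, f (x i) := by
  rw [← Finset.prod_fiberwise' _ x f]
  simp [mult]

theorem ketbraPow_eq_monom (v : Hilb ι) (x y : Fin k → ι) :
    ketbraPow v k x y = monom (mult x) (mult y) v := by
  unfold monom
  rw [Finset.prod_mul_distrib, prod_pow_mult x (fun a => v a),
    prod_pow_mult y (fun a => conj (v a)), ← Finset.prod_mul_distrib]
  rfl

theorem moment_haarState_apply [Nonempty ι] (x y : Fin k → ι) :
    moment (haarState ι) k x y = if mult x = mult y then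
      ((∏ a, (mult x a).factorial : ℕ) : ℂ) / ((Fintype.card ι).ascFactorial k : ℂ) else 0 := by
  simp only [moment, of_apply, ketbraPow_eq_monom]
  exact integral_monom_haarState (sum_mult x) (sum_mult y)

/-- The number of permutations carrying one string to another, by orbit and stabilizer. -/
theorem card_perm_comp_eq (x y : Fin k → ι) :
    (Finset.univ.filter fun π : Equiv.Perm (Fin k) => x ∘ π = y).card
      = if mult x = mult y then ∏ a, (mult x a).factorial else 0 := by
  split_ifs with h
  · obtain ⟨σ, rfl⟩ := exists_comp_perm_eq h
    have h1 := DomMulAct.stabilizer_card x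
    rw [Fintype.card_subtype] at h1
    have h2 : ∀ a, Fintype.card {i // x i = a} = mult x a := fun a => Fintype.card_subtype _
    simp only [h2] at h1
    rw [← h1]
    refine Finset.card_bij (fun π _ => π * σ⁻¹) ?_ ?_ ?_
    · intro π hπ
      simp only [Finset.mem_filter, Finset.mem_univ, true_and] at hπ ⊢
      rw [Equiv.Perm.coe_mul, ← Function.comp_assoc, hπ, Function.comp_assoc,
        ← Equiv.Perm.coe_mul, mul_inv_cancel]
      rfl
    · intro π _ π' _ hh
      exact mul_right_cancel hh
    · intro π hπ
      simp only [Finset.mem_filter, Finset.mem_univ, true_and] at hπ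
      refine ⟨π * σ, ?_, by simp⟩
      simp only [Finset.mem_filter, Finset.mem_univ, true_and]
      rw [Equiv.Perm.coe_mul, ← Function.comp_assoc, hπ]
  · rw [Finset.card_eq_zero, Finset.filter_eq_empty_iff]
    intro π _ hπ
    exact h (by rw [← hπ, mult_comp_perm])

/-- The orthogonal projection onto the symmetric subspace of `H^{⊗ k}`: the average of the
permutations of the tensor factors. -/
def symProj (ι : Type) [Fintype ι] [DecidableEq ι] (k : ℕ) :
    Matrix (Fin k → ι) (Fin k → ι) ℂ :=
  Matrix.of fun x y => (∑ π : Equiv.Perm (Fin k), if x ∘ π = y then 1 else 0) / (k.factorial : ℂ)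

theorem symProj_apply (x y : Fin k → ι) :
    symProj ι k x y = (if mult x = mult y then ((∏ a, (mult x a).factorial : ℕ) : ℂ) else 0)
      / (k.factorial : ℂ) := by
  simp only [symProj, of_apply, Finset.sum_boole, card_perm_comp_eq, Nat.cast_ite, Nat.cast_zero]

theorem symProj_mul_apply {κ : Type} (M : Matrix (Fin k → ι) κ ℂ) (x : Fin k → ι)
    (y : κ) :
    (symProj ι k * M) x y
      = (∑ π : Equiv.Perm (Fin k), M (x ∘ π) y) / (k.factorial : ℂ) := by
  simp only [Matrix.mul_apply, symProj, of_apply, div_mul_eq_mul_div, Finset.sum_mul,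
    ← Finset.sum_div]
  rw [Finset.sum_comm]
  simp

theorem symProj_mul_of_invariant {κ : Type} {M : Matrix (Fin k → ι) κ ℂ}
    (hM : ∀ (π : Equiv.Perm (Fin k)) x y, M (x ∘ π) y = M x y) : symProj ι k * M = M := by
  ext x y
  rw [symProj_mul_apply]
  simp only [hM, Finset.sum_const, Finset.card_univ, Fintype.card_perm, Fintype.card_fin,
    nsmul_eq_mul]
  have : (k.factorial : ℂ) ≠ 0 := by exact_mod_cast k.factorial_ne_zero
  field_simp

theorem symProj_conjTranspose : (symProj ι k)ᴴ = symProj ι k := by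
  ext x y
  rw [conjTranspose_apply, symProj_apply, symProj_apply]
  by_cases h : mult x = mult y
  · simp [h]
  · simp [h, Ne.symm h]

theorem symProj_mul_self : symProj ι k * symProj ι k = symProj ι k :=
  symProj_mul_of_invariant fun π x y => by
    rw [symProj_apply, symProj_apply, mult_comp_perm]

theorem symProj_mul_ketbraPow (v : Hilb ι) :
    symProj ι k * ketbraPow v k = ketbraPow v k :=
  symProj_mul_of_invariant fun π x y => by
    rw [ketbraPow_eq_monom, ketbraPow_eq_monom, mult_comp_perm]

theorem ketbraPow_mul_symProj (v : Hilb ι) :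
    ketbraPow v k * symProj ι k = ketbraPow v k := by
  have h := congrArg conjTranspose (symProj_mul_ketbraPow (k := k) v)
  rwa [conjTranspose_mul, symProj_conjTranspose, ketbraPow_conjTranspose] at h

/-- The Haar moments are the maximally mixed states of the symmetric subspaces. -/
theorem moment_haarState [Nonempty ι] :
    moment (haarState ι) k = ((symDim (Fintype.card ι) k : ℂ))⁻¹ • symProj ι k := by
  ext x y
  rw [moment_haarState_apply, Matrix.smul_apply, symProj_apply, symDim, smul_eq_mul]
  have h1 : (k.factorial : ℂ) ≠ 0 := by exact_mod_cast k.factorial_ne_zero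
  have h2 : ((Fintype.card ι).ascFactorial k : ℂ) ≠ 0 := by
    exact_mod_cast ascFactorial_card_ne_zero ι k
  split_ifs
  · push_cast
    field_simp
  · simp

/-- Read off from the Haar moment, whose trace is one, instead of counting types. -/
theorem trace_symProj [Nonempty ι] :
    (symProj ι k).trace = symDim (Fintype.card ι) k := by
  have h := trace_moment (k := k) (haarState ι)
  have hd : (symDim (Fintype.card ι) k : ℂ) ≠ 0 := by exact_mod_cast (symDim_pos ι k).ne'
  rwa [moment_haarState, trace_smul, smul_eq_mul, inv_mul_eq_one₀ hd, eq_comm] at h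

/-- The normalization of the Haar moments, solved for the rising factorial. -/
theorem sum_prod_factorial_mult (ι : Type) [Fintype ι] [DecidableEq ι] [Nonempty ι] (k : ℕ) :
    ∑ x : Fin k → ι, ((∏ a, (mult x a).factorial : ℕ) : ℂ)
      = ((Fintype.card ι).ascFactorial k : ℂ) := by
  have h := trace_moment (k := k) (haarState ι)
  simp only [trace, diag_apply, moment_haarState_apply, if_true, ← Finset.sum_div] at h
  have h2 : ((Fintype.card ι).ascFactorial k : ℂ) ≠ 0 := by
    exact_mod_cast ascFactorial_card_ne_zero ι k
  exact (div_eq_one_iff_eq h2).1 h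

/-- The identity `tr P ^ 2 = tr P` for the symmetric projection `P`, written out in entries. -/
theorem sum_sum_sq_prod_factorial_mult (ι : Type) [Fintype ι] [DecidableEq ι] [Nonempty ι]
    (k : ℕ) :
    ∑ x : Fin k → ι, ∑ y : Fin k → ι,
      (if mult x = mult y then
        ((∏ a, (mult x a).factorial : ℕ) : ℂ) * ((∏ a, (mult x a).factorial : ℕ) : ℂ) else 0)
      = (k.factorial : ℂ) * ((Fintype.card ι).ascFactorial k : ℂ) := by
  have h := trace_symProj (ι := ι) (k := k)
  have h1 : (k.factorial : ℂ) ≠ 0 := by exact_mod_cast k.factorial_ne_zero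
  rw [← symProj_mul_self, symDim] at h
  have h2 : ∀ x y : Fin k → ι, symProj ι k x y * symProj ι k y x = (if mult x = mult y then
      ((∏ a, (mult x a).factorial : ℕ) : ℂ) * ((∏ a, (mult x a).factorial : ℕ) : ℂ) else 0)
      / ((k.factorial : ℂ) * (k.factorial : ℂ)) := by
    intro x y
    rw [symProj_apply, symProj_apply]
    by_cases hxy : mult x = mult y
    · simp only [hxy, if_true]
      field_simp
    · simp [hxy]
  simp only [trace, diag_apply, Matrix.mul_apply, h2, ← Finset.sum_div] at h
  rw [div_eq_iff (mul_ne_zero h1 h1)] at h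
  rw [h]
  push_cast
  field_simp

/-- The pairing of a moment with a partial permutation matrix sees an approximate design as the
Haar distribution, with an error that does not grow with the size of the permutation. -/
theorem norm_integral_sum_sub_le {μ : Measure (PureState ι)} [IsProbabilityMeasure μ] [Nonempty ι]
    {t : ℕ} {ε : ℝ} (hμ : IsApproxStateDesign μ t ε) {l : ℕ} (hl : l ≤ t)
    (σ : Equiv.Perm (Fin l → ι)) (s : Finset (Fin l → ι)) :
    ‖∫ Φ : PureState ι, ∑ x ∈ s, ketbraPow Φ.1 l x (σ x) ∂μ
      - ∫ Φ : PureState ι, ∑ x ∈ s, ketbraPow Φ.1 l x (σ x) ∂haarState ι‖ ≤ ε := by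
  rw [integral_finsetSum _ fun x _ => integrable_ketbraPow_apply _ _ _,
    integral_finsetSum _ fun x _ => integrable_ketbraPow_apply _ _ _, ← Finset.sum_sub_distrib]
  exact (norm_sum_filter_apply_le_traceNorm σ s _).trans (hμ l hl)

end SymmetricProjection

/-! ### The distance to a design, bounded by polynomials in the state -/

section PointwiseBounds

open Matrix
open scoped ComplexConjugate

variable {ι : Type} [Fintype ι] {k nA nB : ℕ}

theorem ketbraPow_smul (c : ℂ) (v : Hilb ι) :
    ketbraPow (c • v) k = (((‖c‖ ^ 2) ^ k : ℝ) : ℂ) • ketbraPow v k := by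
  ext x y
  have h : ∀ i, (c • v) (x i) * star ((c • v) (y i))
      = ((‖c‖ ^ 2 : ℝ) : ℂ) * (v (x i) * star (v (y i))) := by
    intro i
    simp only [PiLp.smul_apply, smul_eq_mul, star_mul']
    have := Complex.mul_conj' c
    push_cast
    rw [← this]
    simp only [RCLike.star_def]
    ring
  simp only [ketbraPow, of_apply, Matrix.smul_apply, h]
  rw [Finset.prod_mul_distrib, Finset.prod_const, Finset.card_univ, Fintype.card_fin, smul_eq_mul]
  push_cast
  rfl

theorem trace_ketbraPow_mul_ketbraPow (u v : Hilb ι) :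
    (ketbraPow u k * ketbraPow v k).trace = ((‖inner ℂ u v‖ ^ (2 * k) : ℝ) : ℂ) := by
  have h : ∀ a b : Hilb ι, (star fun x : Fin k → ι => ∏ i, a (x i)) ⬝ᵥ (fun x => ∏ i, b (x i))
      = inner ℂ a b ^ k := by
    intro a b
    rw [PiLp.inner_apply, Fintype.sum_pow]
    refine Finset.sum_congr rfl fun x _ => ?_
    simp [Finset.prod_mul_distrib, mul_comm]
  rw [ketbraPow_eq_vecMulVec, ketbraPow_eq_vecMulVec, vecMulVec_mul_vecMulVec, h,
    trace_vecMulVec, dotProduct_smul, dotProduct_comm, h, smul_eq_mul, ← inner_conj_symm v u,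
    ← mul_pow, Complex.mul_conj', pow_mul]
  push_cast
  rfl

theorem outcomeProb_nonneg (Φ : Hilb (Bits nA × Bits nB)) (z : Bits nB) : 0 ≤ outcomeProb Φ z :=
  sq_nonneg _

theorem sum_outcomeProb (Φ : Hilb (Bits nA × Bits nB)) : ∑ z, outcomeProb Φ z = ‖Φ‖ ^ 2 := by
  simp only [outcomeProb, EuclideanSpace.norm_sq_eq, unnormState]
  rw [Fintype.sum_prod_type, Finset.sum_comm]

theorem norm_postState_sq_le (Φ : Hilb (Bits nA × Bits nB)) (z : Bits nB) :
    ‖postState Φ z‖ ^ 2 ≤ 1 := by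
  have : √(outcomeProb Φ z) = ‖unnormState Φ z‖ := Real.sqrt_sq (norm_nonneg _)
  rw [postState, this, norm_smul, norm_inv, Complex.norm_real, norm_norm]
  exact pow_le_one₀ (by positivity) (inv_mul_le_one)

/-- Also valid when the outcome `z` has probability zero, since then both sides vanish. -/
theorem outcomeProb_pow_smul_ketbraPow_postState (hk : k ≠ 0) (Φ : Hilb (Bits nA × Bits nB))
    (z : Bits nB) :
    ((outcomeProb Φ z ^ k : ℝ) : ℂ) • ketbraPow (postState Φ z) k
      = ketbraPow (unnormState Φ z) k := by
  rw [postState, ketbraPow_smul, smul_smul, ← Complex.ofReal_mul, ← mul_pow]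
  by_cases h : outcomeProb Φ z = 0
  · have hv : unnormState Φ z = 0 := by
      rw [outcomeProb] at h
      exact norm_eq_zero.1 (pow_eq_zero_iff two_ne_zero |>.1 h)
    have : ketbraPow (0 : Hilb (Bits nA)) k = 0 := by
      ext x y
      simp [ketbraPow, hk]
    rw [hv, this, smul_zero]
  · have h1 : outcomeProb Φ z * ‖((√(outcomeProb Φ z) : ℂ))⁻¹‖ ^ 2 = 1 := by
      rw [norm_inv, Complex.norm_real, Real.norm_of_nonneg (Real.sqrt_nonneg _), inv_pow,
        Real.sq_sqrt (outcomeProb_nonneg Φ z), mul_inv_cancel₀ h]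
    rw [h1, one_pow, Complex.ofReal_one, one_smul]

/-- `∑ z, q_z ^ m`. -/
def probMoment (Φ : Hilb (Bits nA × Bits nB)) (m : ℕ) : ℝ := ∑ z, outcomeProb Φ z ^ m

/-- `∑ z z', |⟨Φ̃_z|Φ̃_z'⟩| ^ (2k)`, the squared Frobenius norm of
`∑ z, (|Φ̃_z⟩⟨Φ̃_z|)^{⊗ k}`. -/
def overlapMoment (Φ : Hilb (Bits nA × Bits nB)) (k : ℕ) : ℝ :=
  ∑ z, ∑ z', ‖inner ℂ (unnormState Φ z) (unnormState Φ z')‖ ^ (2 * k)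

theorem traceNorm_sum_smul_ketbraPow_postState_le (Φ : Hilb (Bits nA × Bits nB))
    (a : Bits nB → ℝ) (k : ℕ) :
    traceNorm (∑ z, (a z : ℂ) • ketbraPow (postState Φ z) k) ≤ ∑ z, |a z| := by
  simp only [ketbraPow_eq_vecMulVec]
  refine (traceNorm_sum_smul_vecMulVec_le a _).trans (Finset.sum_le_sum fun z _ => ?_)
  rw [sum_norm_sq_prod]
  exact mul_le_of_le_one_right (abs_nonneg _)
    (pow_le_one₀ (sq_nonneg _) (norm_postState_sq_le Φ z))

theorem traceNorm_projectedMoment_le {Φ : Hilb (Bits nA × Bits nB)} (hΦ : ‖Φ‖ = 1) (k : ℕ) :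
    traceNorm (projectedMoment Φ k) ≤ 1 := by
  refine (traceNorm_sum_smul_ketbraPow_postState_le Φ _ k).trans (le_of_eq ?_)
  simp only [abs_of_nonneg (outcomeProb_nonneg Φ _)]
  rw [sum_outcomeProb, hΦ, one_pow]

/-- Cost of replacing the rational function `q_z ^ (-j)` of the state by the constant `b ^ j`. -/
theorem sq_traceNorm_projectedMoment_sub_le {Φ : Hilb (Bits nA × Bits nB)} (hΦ : ‖Φ‖ = 1) (j : ℕ)
    (b : ℝ) :
    traceNorm (projectedMoment Φ (j + 1)
        - ((b ^ j : ℝ) : ℂ) • ∑ z, ketbraPow (unnormState Φ z) (j + 1)) ^ 2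
      ≤ 1 - 2 * b ^ j * probMoment Φ (j + 1) + b ^ (2 * j) * probMoment Φ (2 * j + 1) := by
  have h1 : projectedMoment Φ (j + 1)
        - ((b ^ j : ℝ) : ℂ) • ∑ z, ketbraPow (unnormState Φ z) (j + 1)
      = ∑ z, ((outcomeProb Φ z * (1 - (b * outcomeProb Φ z) ^ j) : ℝ) : ℂ)
          • ketbraPow (postState Φ z) (j + 1) := by
    rw [projectedMoment, Finset.smul_sum, ← Finset.sum_sub_distrib]
    refine Finset.sum_congr rfl fun z _ => ?_
    rw [← outcomeProb_pow_smul_ketbraPow_postState j.succ_ne_zero, smul_smul, ← sub_smul]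
    congr 1
    push_cast
    rw [Nat.succ_eq_add_one]
    ring
  have hsum : ∑ z, outcomeProb Φ z = 1 := by rw [sum_outcomeProb, hΦ, one_pow]
  -- Cauchy–Schwarz with the probability weights `q_z`
  have h2 := Real.sum_mul_le_sqrt_mul_sqrt Finset.univ (fun z => √(outcomeProb Φ z))
    (fun z => √(outcomeProb Φ z) * |1 - (b * outcomeProb Φ z) ^ j|)
  have h3 := (traceNorm_sum_smul_ketbraPow_postState_le Φ
    (fun z => outcomeProb Φ z * (1 - (b * outcomeProb Φ z) ^ j)) (j + 1)).trans
    (le_of_eq_of_le (Finset.sum_congr rfl fun z _ => by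
      rw [abs_mul, abs_of_nonneg (outcomeProb_nonneg Φ z), ← mul_assoc,
        Real.mul_self_sqrt (outcomeProb_nonneg Φ z)]) h2)
  rw [h1]
  have h4 := pow_le_pow_left₀ (traceNorm_nonneg _) h3 2
  refine h4.trans (le_of_eq ?_)
  simp only [mul_pow, Real.sq_sqrt (outcomeProb_nonneg Φ _), sq_abs]
  rw [hsum, Real.sqrt_one, one_pow, one_mul, Real.sq_sqrt (Finset.sum_nonneg fun z _ =>
    mul_nonneg (outcomeProb_nonneg Φ z) (sq_nonneg _))]
  conv_rhs => rw [← hsum]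
  simp only [probMoment, Finset.mul_sum]
  rw [← Finset.sum_sub_distrib, ← Finset.sum_add_distrib]
  refine Finset.sum_congr rfl fun z _ => ?_
  ring

theorem traceNorm_moment_haarState_le (ι : Type) [Fintype ι] [DecidableEq ι] [Nonempty ι] (k : ℕ) :
    traceNorm (moment (haarState ι) k) ≤ 1 := by
  have hd := symDim_pos ι k
  rw [moment_haarState]
  refine (traceNorm_le_sqrt_mul_sqrt (symProj_mul_self (k := k)) symProj_conjTranspose
    trace_symProj (by rw [Matrix.smul_mul, symProj_mul_self])).trans ?_
  have h : ∑ x, ∑ y, ‖((symDim (Fintype.card ι) k : ℂ)⁻¹ • symProj ι k) x y‖ ^ 2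
      = (symDim (Fintype.card ι) k)⁻¹ := by
    have h1 : ((∑ x, ∑ y, ‖symProj ι k x y‖ ^ 2 : ℝ) : ℂ) = symDim (Fintype.card ι) k := by
      rw [sum_norm_sq_eq_trace_mul_self symProj_conjTranspose, symProj_mul_self, trace_symProj]
    have h2 : ∑ x, ∑ y, ‖symProj ι k x y‖ ^ 2 = symDim (Fintype.card ι) k := by exact_mod_cast h1
    simp only [Matrix.smul_apply, norm_smul, mul_pow, ← Finset.mul_sum, h2, norm_inv,
      Complex.norm_real, Real.norm_of_nonneg hd.le]
    field_simp
  rw [h, ← Real.sqrt_mul hd.le, mul_inv_cancel₀ hd.ne', Real.sqrt_one]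

/-- Distance in trace norm of the unnormalized ensemble from the Haar moment, in terms of
polynomials of the state. -/
theorem sq_traceNorm_sub_moment_haarState_le (Φ : Hilb (Bits nA × Bits nB)) (k : ℕ) (β : ℝ) :
    traceNorm ((β : ℂ) • ∑ z, ketbraPow (unnormState Φ z) k - moment (haarState (Bits nA)) k) ^ 2
      ≤ symDim (Fintype.card (Bits nA)) k * β ^ 2 * overlapMoment Φ k
        - 2 * β * probMoment Φ k + 1 := by
  set d := symDim (Fintype.card (Bits nA)) k with hd
  have hd0 : 0 < d := symDim_pos _ _
  set K := ∑ z, ketbraPow (unnormState Φ z) k with hK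
  set P := symProj (Bits nA) k with hP
  set X := (β : ℂ) • K - (d : ℂ)⁻¹ • P with hX
  have hKP : K * P = K := by
    rw [hK, Finset.sum_mul]
    exact Finset.sum_congr rfl fun z _ => ketbraPow_mul_symProj _
  have hPK : P * K = K := by
    rw [hK, Finset.mul_sum]
    exact Finset.sum_congr rfl fun z _ => symProj_mul_ketbraPow _
  have hPP : P * P = P := symProj_mul_self
  have hPH : Pᴴ = P := symProj_conjTranspose
  have hPt : P.trace = d := trace_symProj
  have hKH : Kᴴ = K := by
    rw [hK, conjTranspose_sum]
    exact Finset.sum_congr rfl fun z _ => ketbraPow_conjTranspose _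
  have hXP : X * P = X := by rw [hX, Matrix.sub_mul, Matrix.smul_mul, Matrix.smul_mul, hKP, hPP]
  have hXH : Xᴴ = X := by
    rw [hX, conjTranspose_sub, conjTranspose_smul, conjTranspose_smul, hKH, hPH]
    simp
  have hKK : (K * K).trace = overlapMoment Φ k := by
    rw [hK, Finset.sum_mul, trace_sum, overlapMoment, Complex.ofReal_sum]
    refine Finset.sum_congr rfl fun z _ => ?_
    rw [Finset.mul_sum, trace_sum, Complex.ofReal_sum]
    exact Finset.sum_congr rfl fun z' _ => trace_ketbraPow_mul_ketbraPow _ _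
  have hKt : K.trace = probMoment Φ k := by
    rw [hK, trace_sum, probMoment, Complex.ofReal_sum]
    exact Finset.sum_congr rfl fun z _ => trace_ketbraPow _
  have hF : ∑ x, ∑ y, ‖X x y‖ ^ 2
      = β ^ 2 * overlapMoment Φ k - 2 * β * d⁻¹ * probMoment Φ k + d⁻¹ := by
    have h1 := sum_norm_sq_eq_trace_mul_self hXH
    have h2 : (X * X).trace
        = ((β ^ 2 * overlapMoment Φ k - 2 * β * d⁻¹ * probMoment Φ k + d⁻¹ : ℝ) : ℂ) := by
      rw [hX]
      simp only [Matrix.sub_mul, Matrix.mul_sub, Matrix.smul_mul, Matrix.mul_smul, hKP, hPK, hPP,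
        trace_sub, trace_smul, hKK, hKt, hPt, smul_eq_mul]
      have : (d : ℂ) ≠ 0 := by exact_mod_cast hd0.ne'
      push_cast
      field_simp
      ring
    rw [h2] at h1
    exact_mod_cast h1
  rw [moment_haarState, ← hd, ← hP, ← hX]
  have h3 := traceNorm_le_sqrt_mul_sqrt hPP hPH hPt hXP
  have h4 := pow_le_pow_left₀ (traceNorm_nonneg _) h3 2
  refine h4.trans (le_of_eq ?_)
  rw [mul_pow, Real.sq_sqrt hd0.le, Real.sq_sqrt (by positivity), hF]
  field_simp

end PointwiseBounds

/-! ### Haar averages of the polynomials and their robustness under approximate designs -/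

section Expectations

open Matrix

variable {k m nA nB : ℕ}

theorem mult_append {ι : Type} [DecidableEq ι] {p q : ℕ} (x : Fin p → ι) (y : Fin q → ι) (a : ι) :
    mult (Fin.append x y) a = mult x a + mult y a := by
  simp only [mult, Finset.card_filter, Fin.sum_univ_add, Fin.append_left, Fin.append_right]

theorem mult_prodMk {α β : Type} [DecidableEq α] [DecidableEq β] {p : ℕ} (x : Fin p → α) (z : β)
    (a : α) (b : β) : mult (fun i => (x i, z)) (a, b) = if b = z then mult x a else 0 := by
  simp only [mult, Finset.card_filter, Prod.mk.injEq, ite_and]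
  by_cases h : b = z
  · simp [h]
  · simp [h, Ne.symm h]

/-- The string over `A × B` which reads `x` on its `A`-side and is constantly `z` on its
`B`-side. -/
def tagged (p : Bits nB × (Fin m → Bits nA)) : Fin m → Bits nA × Bits nB := fun i => (p.2 i, p.1)

/-- The concatenation of `x` tagged with `z` and `y` tagged with `z'`. -/
def taggedPair (p : (Bits nB × Bits nB) × ((Fin k → Bits nA) × (Fin k → Bits nA))) :
    Fin (k + k) → Bits nA × Bits nB :=
  Fin.append (fun i => (p.2.1 i, p.1.1)) (fun i => (p.2.2 i, p.1.2))

/-- The permutation operator that exchanges the `A`-sides of the two halves of a string. -/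
def swapA (α β : Type) (k : ℕ) : Equiv.Perm (Fin (k + k) → α × β) :=
  Function.Involutive.toPerm (fun X i => ((X (finAddFlip i)).1, (X i).2)) fun X => by
    ext i
    · simp only
      congr 2
      exact finAddFlip.symm_apply_apply i
    · rfl

theorem tagged_injective (hm : m ≠ 0) :
    Function.Injective (tagged : Bits nB × (Fin m → Bits nA) → _) := by
  rintro ⟨z, x⟩ ⟨z', x'⟩ h
  have h' : ∀ i, x i = x' i ∧ z = z' := fun i => Prod.mk.inj (congrFun h i)
  exact Prod.ext (h' ⟨0, Nat.pos_of_ne_zero hm⟩).2 (funext fun i => (h' i).1)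

theorem taggedPair_injective (hk : k ≠ 0) :
    Function.Injective
      (taggedPair : (Bits nB × Bits nB) × ((Fin k → Bits nA) × (Fin k → Bits nA)) → _) := by
  rintro ⟨⟨z, w⟩, x, y⟩ ⟨⟨z', w'⟩, x', y'⟩ h
  have h1 : ∀ i, x i = x' i ∧ z = z' := fun i => by
    have := congrFun h (Fin.castAdd k i)
    simp only [taggedPair, Fin.append_left] at this
    exact Prod.mk.inj this
  have h2 : ∀ i, y i = y' i ∧ w = w' := fun i => by
    have := congrFun h (Fin.natAdd k i)
    simp only [taggedPair, Fin.append_right] at this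
    exact Prod.mk.inj this
  have i0 : Fin k := ⟨0, Nat.pos_of_ne_zero hk⟩
  exact Prod.ext (Prod.ext (h1 i0).2 (h2 i0).2)
    (Prod.ext (funext fun i => (h1 i).1) (funext fun i => (h2 i).1))

theorem swapA_taggedPair (z z' : Bits nB) (x y : Fin k → Bits nA) :
    swapA (Bits nA) (Bits nB) k (taggedPair ((z, z'), (x, y))) = taggedPair ((z, z'), (y, x)) := by
  funext i
  change ((taggedPair ((z, z'), (x, y)) (finAddFlip i)).1, (taggedPair ((z, z'), (x, y)) i).2) = _
  refine Fin.addCases (fun i => ?_) (fun i => ?_) i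
  · rw [finAddFlip_apply_castAdd]
    simp only [taggedPair, Fin.append_left, Fin.append_right]
  · rw [finAddFlip_apply_natAdd]
    simp only [taggedPair, Fin.append_left, Fin.append_right]

theorem outcomeProb_pow_eq (Φ : Hilb (Bits nA × Bits nB)) (z : Bits nB) (m : ℕ) :
    ((outcomeProb Φ z ^ m : ℝ) : ℂ)
      = ∑ x, ketbraPow Φ m (tagged (z, x)) (tagged (z, x)) :=
  (trace_ketbraPow (unnormState Φ z)).symm

theorem norm_inner_pow_eq (Φ : Hilb (Bits nA × Bits nB)) (z z' : Bits nB) (k : ℕ) :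
    ((‖inner ℂ (unnormState Φ z) (unnormState Φ z')‖ ^ (2 * k) : ℝ) : ℂ)
      = ∑ p : (Fin k → Bits nA) × (Fin k → Bits nA),
          ketbraPow Φ (k + k) (taggedPair ((z, z'), p)) (taggedPair ((z, z'), p.swap)) := by
  rw [← trace_ketbraPow_mul_ketbraPow, Fintype.sum_prod_type]
  simp only [trace, diag_apply, Matrix.mul_apply]
  refine Finset.sum_congr rfl fun x _ => Finset.sum_congr rfl fun y _ => ?_
  simp only [ketbraPow, of_apply, Fin.prod_univ_add, taggedPair, Fin.append_left, Fin.append_right,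
    unnormState, Prod.fst_swap, Prod.snd_swap]

/-- The power sum of the outcome probabilities is the expectation of a diagonal projection in the
state `(|Φ⟩⟨Φ|)^{⊗ m}`. -/
theorem probMoment_eq (hm : m ≠ 0) (Φ : Hilb (Bits nA × Bits nB)) :
    (probMoment Φ m : ℂ) = ∑ x ∈ Finset.univ.image (tagged : Bits nB × (Fin m → Bits nA) → _),
      ketbraPow Φ m x (Equiv.refl (Fin m → Bits nA × Bits nB) x) := by
  rw [Finset.sum_image fun _ _ _ _ h => tagged_injective hm h, Fintype.sum_prod_type, probMoment,
    Complex.ofReal_sum]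
  exact Finset.sum_congr rfl fun z _ => outcomeProb_pow_eq Φ z m

/-- All the overlaps are collected by a single partial permutation operator on `2k` copies: the
operators which belong to different pairs of outcomes have orthogonal supports and ranges. -/
theorem overlapMoment_eq (hk : k ≠ 0) (Φ : Hilb (Bits nA × Bits nB)) :
    (overlapMoment Φ k : ℂ) = ∑ x ∈ Finset.univ.image
        (taggedPair : (Bits nB × Bits nB) × ((Fin k → Bits nA) × (Fin k → Bits nA)) → _),
      ketbraPow Φ (k + k) x (swapA (Bits nA) (Bits nB) k x) := by
  rw [Finset.sum_image fun _ _ _ _ h => taggedPair_injective hk h, Fintype.sum_prod_type,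
    Fintype.sum_prod_type, overlapMoment, Complex.ofReal_sum]
  refine Finset.sum_congr rfl fun z _ => ?_
  rw [Complex.ofReal_sum]
  refine Finset.sum_congr rfl fun z' _ => ?_
  rw [norm_inner_pow_eq]
  exact Finset.sum_congr rfl fun p _ => by rw [swapA_taggedPair]; rfl

variable {μ : Measure (PureState (Bits nA × Bits nB))} [IsProbabilityMeasure μ] {t : ℕ} {ε : ℝ}

theorem abs_integral_probMoment_sub_le (hμ : IsApproxStateDesign μ t ε) (hm : m ≠ 0) (hmt : m ≤ t) :
    |∫ Φ, probMoment Φ.1 m ∂μ - ∫ Φ, probMoment Φ.1 m ∂haarState (Bits nA × Bits nB)| ≤ ε := by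
  have h := norm_integral_sum_sub_le hμ hmt (Equiv.refl _)
    (Finset.univ.image (tagged : Bits nB × (Fin m → Bits nA) → _))
  simp only [← probMoment_eq hm] at h
  rwa [integral_complex_ofReal, integral_complex_ofReal, ← Complex.ofReal_sub, Complex.norm_real]
    at h

theorem abs_integral_overlapMoment_sub_le (hμ : IsApproxStateDesign μ t ε) (hk : k ≠ 0)
    (hkt : k + k ≤ t) :
    |∫ Φ, overlapMoment Φ.1 k ∂μ - ∫ Φ, overlapMoment Φ.1 k ∂haarState (Bits nA × Bits nB)|
      ≤ ε := by
  have h := norm_integral_sum_sub_le hμ hkt (swapA _ _ k)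
    (Finset.univ.image
      (taggedPair : (Bits nB × Bits nB) × ((Fin k → Bits nA) × (Fin k → Bits nA)) → _))
  simp only [← overlapMoment_eq hk] at h
  rwa [integral_complex_ofReal, integral_complex_ofReal, ← Complex.ofReal_sub, Complex.norm_real]
    at h

theorem prod_factorial_mult_tagged (z : Bits nB) (x : Fin m → Bits nA) :
    ∏ a, (mult (tagged (z, x)) a).factorial = ∏ a, (mult x a).factorial := by
  rw [Fintype.prod_prod_type]
  refine Finset.prod_congr rfl fun a _ => ?_
  rw [Finset.prod_eq_single z]
  · exact congrArg Nat.factorial ((mult_prodMk x z a z).trans (if_pos rfl))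
  · intro b _ hb
    rw [show mult (tagged (z, x)) (a, b) = 0 from (mult_prodMk x z a b).trans (if_neg hb)]
    rfl
  · simp

theorem mult_taggedPair (z z' : Bits nB) (x y : Fin k → Bits nA) (a : Bits nA) (b : Bits nB) :
    mult (taggedPair ((z, z'), (x, y))) (a, b)
      = (if b = z then mult x a else 0) + if b = z' then mult y a else 0 := by
  simp only [taggedPair, mult_append, mult_prodMk]

theorem prod_factorial_mult_taggedPair {z z' : Bits nB} (hz : z ≠ z') (x y : Fin k → Bits nA) :
    ∏ a, (mult (taggedPair ((z, z'), (x, y))) a).factorial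
      = (∏ a, (mult x a).factorial) * ∏ a, (mult y a).factorial := by
  rw [Fintype.prod_prod_type, ← Finset.prod_mul_distrib]
  refine Finset.prod_congr rfl fun a _ => ?_
  simp only [mult_taggedPair]
  rw [Finset.prod_eq_mul z z' hz]
  · simp [hz, hz.symm]
  · intro b _ hb
    simp [hb.1, hb.2]
  · simp
  · simp

theorem mult_taggedPair_eq_iff {z z' : Bits nB} (hz : z ≠ z') (x y : Fin k → Bits nA) :
    mult (taggedPair ((z, z'), (x, y))) = mult (taggedPair ((z, z'), (y, x)))
      ↔ mult x = mult y := by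
  constructor
  · intro h
    ext a
    have := congrFun h (a, z)
    simpa [mult_taggedPair, hz] using this
  · intro h
    ext ⟨a, b⟩
    simp [mult_taggedPair, h]

theorem continuous_unnormState (z : Bits nB) :
    Continuous fun Φ : Hilb (Bits nA × Bits nB) => unnormState Φ z := by
  unfold unnormState
  fun_prop

theorem continuous_outcomeProb (z : Bits nB) :
    Continuous fun Φ : Hilb (Bits nA × Bits nB) => outcomeProb Φ z :=
  (continuous_unnormState z).norm.pow 2

theorem continuous_probMoment (m : ℕ) :
    Continuous fun Φ : PureState (Bits nA × Bits nB) => probMoment Φ.1 m :=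
  continuous_finsetSum _ fun z _ => ((continuous_outcomeProb z).comp continuous_subtype_val).pow m

theorem continuous_overlapMoment (k : ℕ) :
    Continuous fun Φ : PureState (Bits nA × Bits nB) => overlapMoment Φ.1 k :=
  continuous_finsetSum _ fun z _ => continuous_finsetSum _ fun z' _ =>
    ((((continuous_unnormState z).comp continuous_subtype_val).inner
      ((continuous_unnormState z').comp continuous_subtype_val)).norm).pow _

theorem integral_outcomeProb_pow_haarState (z : Bits nB) (m : ℕ) :
    ∫ Φ, outcomeProb Φ.1 z ^ m ∂haarState (Bits nA × Bits nB)
      = ((Fintype.card (Bits nA)).ascFactorial m : ℝ)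
        / ((Fintype.card (Bits nA × Bits nB)).ascFactorial m : ℝ) := by
  rw [← Complex.ofReal_inj, ← integral_complex_ofReal]
  simp only [outcomeProb_pow_eq]
  rw [integral_finsetSum _ fun x _ => integrable_ketbraPow_apply _ _ _]
  have h : ∀ x : Fin m → Bits nA, ∫ Φ : PureState (Bits nA × Bits nB),
      ketbraPow Φ.1 m (tagged (z, x)) (tagged (z, x)) ∂haarState (Bits nA × Bits nB)
      = ((∏ a, (mult x a).factorial : ℕ) : ℂ)
        / ((Fintype.card (Bits nA × Bits nB)).ascFactorial m : ℂ) := by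
    intro x
    have := moment_haarState_apply (tagged (z, x)) (tagged (z, x))
    rw [if_pos rfl, prod_factorial_mult_tagged] at this
    exact this
  simp only [h]
  rw [← Finset.sum_div, sum_prod_factorial_mult]
  push_cast
  rfl

theorem integral_norm_inner_pow_haarState {z z' : Bits nB} (hz : z ≠ z') (k : ℕ) :
    ∫ Φ, ‖inner ℂ (unnormState Φ.1 z) (unnormState Φ.1 z')‖ ^ (2 * k)
        ∂haarState (Bits nA × Bits nB)
      = (k.factorial : ℝ) * ((Fintype.card (Bits nA)).ascFactorial k : ℝ)
        / ((Fintype.card (Bits nA × Bits nB)).ascFactorial (k + k) : ℝ) := by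
  rw [← Complex.ofReal_inj, ← integral_complex_ofReal]
  simp only [norm_inner_pow_eq]
  rw [integral_finsetSum _ fun x _ => integrable_ketbraPow_apply _ _ _]
  have h : ∀ x y : Fin k → Bits nA, ∫ Φ : PureState (Bits nA × Bits nB),
      ketbraPow Φ.1 (k + k) (taggedPair ((z, z'), (x, y))) (taggedPair ((z, z'), (y, x)))
        ∂haarState (Bits nA × Bits nB)
      = (if mult x = mult y then
        ((∏ a, (mult x a).factorial : ℕ) : ℂ) * ((∏ a, (mult x a).factorial : ℕ) : ℂ) else 0)
        / ((Fintype.card (Bits nA × Bits nB)).ascFactorial (k + k) : ℂ) := by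
    intro x y
    have := moment_haarState_apply (taggedPair ((z, z'), (x, y))) (taggedPair ((z, z'), (y, x)))
    simp only [mult_taggedPair_eq_iff hz, prod_factorial_mult_taggedPair hz] at this
    refine Eq.trans this ?_
    by_cases hxy : mult x = mult y
    · simp [hxy]
    · simp [hxy]
  rw [Fintype.sum_prod_type]
  simp only [Prod.swap_prod_mk, h]
  simp only [← Finset.sum_div]
  rw [sum_sum_sq_prod_factorial_mult]
  push_cast
  rfl

theorem integral_probMoment_haarState (nA nB m : ℕ) :
    ∫ Φ, probMoment Φ.1 m ∂haarState (Bits nA × Bits nB)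
      = (Fintype.card (Bits nB) : ℝ) * (((Fintype.card (Bits nA)).ascFactorial m : ℝ)
        / ((Fintype.card (Bits nA × Bits nB)).ascFactorial m : ℝ)) := by
  have hint : ∀ z : Bits nB, Integrable (fun Φ : PureState (Bits nA × Bits nB) =>
      outcomeProb Φ.1 z ^ m) (haarState (Bits nA × Bits nB)) := fun z =>
    Continuous.integrable_pureState
      (((continuous_outcomeProb z).comp continuous_subtype_val).pow m) _
  simp only [probMoment]
  rw [integral_finsetSum _ fun z _ => hint z]
  simp only [integral_outcomeProb_pow_haarState, Finset.sum_const, Finset.card_univ, nsmul_eq_mul]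

/-- Diagonal terms contribute a power of a single outcome probability; off the diagonal the two
post-measurement states are independent Haar states. -/
theorem integral_overlapMoment_haarState_le (nA nB k : ℕ) :
    ∫ Φ, overlapMoment Φ.1 k ∂haarState (Bits nA × Bits nB)
      ≤ (Fintype.card (Bits nB) : ℝ) * (((Fintype.card (Bits nA)).ascFactorial (k + k) : ℝ)
          / ((Fintype.card (Bits nA × Bits nB)).ascFactorial (k + k) : ℝ))
        + (Fintype.card (Bits nB) : ℝ) ^ 2
          * ((k.factorial : ℝ) * ((Fintype.card (Bits nA)).ascFactorial k : ℝ)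
            / ((Fintype.card (Bits nA × Bits nB)).ascFactorial (k + k) : ℝ)) := by
  have hint : ∀ z z' : Bits nB, Integrable (fun Φ : PureState (Bits nA × Bits nB) =>
      ‖inner ℂ (unnormState Φ.1 z) (unnormState Φ.1 z')‖ ^ (2 * k))
      (haarState (Bits nA × Bits nB)) := fun z z' => Continuous.integrable_pureState
    (((((continuous_unnormState z).comp continuous_subtype_val).inner
      ((continuous_unnormState z').comp continuous_subtype_val)).norm).pow _) _
  simp only [overlapMoment]
  rw [integral_finsetSum _ fun z _ => integrable_finsetSum _ fun z' _ => hint z z']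
  simp only [integral_finsetSum _ fun z' _ => hint _ z']
  set P := ((Fintype.card (Bits nA)).ascFactorial (k + k) : ℝ)
          / ((Fintype.card (Bits nA × Bits nB)).ascFactorial (k + k) : ℝ) with hP
  set Q := (k.factorial : ℝ) * ((Fintype.card (Bits nA)).ascFactorial k : ℝ)
            / ((Fintype.card (Bits nA × Bits nB)).ascFactorial (k + k) : ℝ) with hQ
  have hQ0 : 0 ≤ Q := by positivity
  have h : ∀ z z' : Bits nB, ∫ Φ : PureState (Bits nA × Bits nB),
      ‖inner ℂ (unnormState Φ.1 z) (unnormState Φ.1 z')‖ ^ (2 * k) ∂haarState (Bits nA × Bits nB)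
      ≤ (if z = z' then P else 0) + Q := by
    intro z z'
    by_cases hz : z = z'
    · subst hz
      rw [if_pos rfl, hP, ← integral_outcomeProb_pow_haarState z]
      refine le_add_of_le_of_nonneg (le_of_eq ?_) hQ0
      congr 1
      ext Φ
      rw [inner_self_eq_norm_sq_to_K, outcomeProb, ← two_mul]
      simp
    · rw [if_neg hz, zero_add, integral_norm_inner_pow_haarState hz]
  refine (Finset.sum_le_sum fun z _ => Finset.sum_le_sum fun z' _ => h z z').trans (le_of_eq ?_)
  simp only [Finset.sum_add_distrib, Finset.sum_ite_eq, Finset.mem_univ, if_true, Finset.sum_const,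
    Finset.card_univ, nsmul_eq_mul]
  ring

end Expectations

/-! ### Bounds on rising factorials -/

section RisingFactorials

theorem pow_le_ascFactorial (n m : ℕ) : n ^ m ≤ n.ascFactorial m := by
  induction m with
  | zero => simp
  | succ m ih =>
    rw [Nat.ascFactorial_succ, pow_succ']
    exact Nat.mul_le_mul (Nat.le_add_right n m) ih

theorem ascFactorial_mul_le {b : ℕ} (hb : 0 < b) (a m : ℕ) :
    (a * b).ascFactorial m ≤ b ^ m * a.ascFactorial m := by
  induction m with
  | zero => simp
  | succ m ih =>
    rw [Nat.ascFactorial_succ, Nat.ascFactorial_succ, pow_succ']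
    calc (a * b + m) * (a * b).ascFactorial m
        ≤ (b * (a + m)) * (b ^ m * a.ascFactorial m) := Nat.mul_le_mul (by nlinarith) ih
      _ = _ := by ring

theorem ascFactorial_le_factorial_mul_pow {a : ℕ} (ha : 0 < a) (m : ℕ) :
    a.ascFactorial m ≤ m.factorial * a ^ m := by
  induction m with
  | zero => simp
  | succ m ih =>
    rw [Nat.ascFactorial_succ, Nat.factorial_succ, pow_succ']
    calc (a + m) * a.ascFactorial m
        ≤ ((m + 1) * a) * (m.factorial * a ^ m) := Nat.mul_le_mul (by nlinarith) ih
      _ = _ := by ring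

theorem ascFactorial_le_pow_mul_exp {a : ℕ} (ha : 0 < a) (m : ℕ) :
    (a.ascFactorial m : ℝ) ≤ a ^ m * Real.exp (m ^ 2 / (2 * a)) := by
  have ha' : (0 : ℝ) < a := by exact_mod_cast ha
  induction m with
  | zero => simp
  | succ m ih =>
    rw [Nat.ascFactorial_succ]
    push_cast
    have h1 : (a : ℝ) + m ≤ a * Real.exp (m / a) := by
      have := Real.add_one_le_exp ((m : ℝ) / a)
      calc (a : ℝ) + m = a * (m / a + 1) := by field_simp; ring
        _ ≤ _ := by gcongr
    have h2 : Real.exp ((m : ℝ) / a) * Real.exp ((m : ℝ) ^ 2 / (2 * a))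
        ≤ Real.exp (((m : ℝ) + 1) ^ 2 / (2 * a)) := by
      rw [← Real.exp_add]
      gcongr
      have : (m : ℝ) / a + m ^ 2 / (2 * a) = (m ^ 2 + 2 * m) / (2 * a) := by field_simp; ring
      rw [this]
      gcongr
      nlinarith
    calc ((a : ℝ) + m) * (a.ascFactorial m : ℝ)
        ≤ (a * Real.exp (m / a)) * (a ^ m * Real.exp (m ^ 2 / (2 * a))) := by gcongr
      _ = a ^ (m + 1) * (Real.exp ((m : ℝ) / a) * Real.exp ((m : ℝ) ^ 2 / (2 * a))) := by ring
      _ ≤ _ := by gcongr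

theorem symDim_le_pow {a : ℕ} (ha : 0 < a) (k : ℕ) : symDim a k ≤ (a : ℝ) ^ k := by
  rw [symDim, div_le_iff₀ (by exact_mod_cast k.factorial_pos), mul_comm]
  exact_mod_cast ascFactorial_le_factorial_mul_pow ha k

end RisingFactorials

/-! ### Markov inequality for the squared distance -/

section Concentration

variable {nA nB : ℕ}

theorem card_bits (n : ℕ) : Fintype.card (Bits n) = 2 ^ n := by simp

/-- A polynomial in the state and its conjugate, of degree `2(j + 1)` in each, which dominates the
squared distance of the projected ensemble from a `(j + 1)`-design. -/
def errBound (Φ : Hilb (Bits nA × Bits nB)) (j : ℕ) : ℝ :=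
  2 * ((1 - 2 * ((2 : ℝ) ^ nB) ^ j * probMoment Φ (j + 1)
      + ((2 : ℝ) ^ nB) ^ (2 * j) * probMoment Φ (2 * j + 1))
    + (symDim (2 ^ nA) (j + 1) * ((2 : ℝ) ^ nB) ^ (2 * j) * overlapMoment Φ (j + 1)
      - 2 * ((2 : ℝ) ^ nB) ^ j * probMoment Φ (j + 1) + 1))

theorem sq_traceNorm_le_errBound {Φ : Hilb (Bits nA × Bits nB)} (hΦ : ‖Φ‖ = 1) (j : ℕ) :
    traceNorm (projectedMoment Φ (j + 1) - moment (haarState (Bits nA)) (j + 1)) ^ 2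
      ≤ errBound Φ j := by
  set b : ℝ := (2 : ℝ) ^ nB with hb
  set M := (((b ^ j : ℝ) : ℂ)) • ∑ z, ketbraPow (unnormState Φ z) (j + 1) with hM
  have h1 := sq_traceNorm_projectedMoment_sub_le hΦ j b
  have h2 := sq_traceNorm_sub_moment_haarState_le Φ (j + 1) (b ^ j)
  rw [card_bits, ← pow_mul b j 2, mul_comm j 2] at h2
  rw [← hM] at h1 h2
  have h3 := traceNorm_add_le (projectedMoment Φ (j + 1) - M)
    (M - moment (haarState (Bits nA)) (j + 1))
  rw [sub_add_sub_cancel] at h3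
  have h4 := pow_le_pow_left₀ (traceNorm_nonneg _) h3 2
  have h5 := add_sq_le (a := traceNorm (projectedMoment Φ (j + 1) - M))
    (b := traceNorm (M - moment (haarState (Bits nA)) (j + 1)))
  rw [errBound, ← hb]
  linarith

theorem continuous_errBound (j : ℕ) :
    Continuous fun Φ : PureState (Bits nA × Bits nB) => errBound Φ.1 j := by
  have h1 := continuous_probMoment (nA := nA) (nB := nB) (j + 1)
  have h2 := continuous_probMoment (nA := nA) (nB := nB) (2 * j + 1)
  have h3 := continuous_overlapMoment (nA := nA) (nB := nB) (j + 1)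
  unfold errBound
  fun_prop

theorem one_le_pow_mul_integral_probMoment_haarState (nA nB j : ℕ) :
    1 ≤ ((2 : ℝ) ^ nB) ^ j * ∫ Φ, probMoment Φ.1 (j + 1) ∂haarState (Bits nA × Bits nB) := by
  rw [integral_probMoment_haarState, Fintype.card_prod, card_bits, card_bits]
  have h := ascFactorial_mul_le (b := 2 ^ nB) (by positivity) (2 ^ nA) (j + 1)
  have h0 : 0 < (2 ^ nA * 2 ^ nB).ascFactorial (j + 1) :=
    lt_of_lt_of_le (by positivity) (pow_le_ascFactorial _ _)
  have h' : (((2 ^ nA * 2 ^ nB).ascFactorial (j + 1) : ℕ) : ℝ)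
      ≤ ((2 : ℝ) ^ nB) ^ (j + 1) * ((2 ^ nA).ascFactorial (j + 1) : ℕ) := by exact_mod_cast h
  have h0' : (0 : ℝ) < (((2 ^ nA * 2 ^ nB).ascFactorial (j + 1) : ℕ) : ℝ) := by exact_mod_cast h0
  rw [← mul_assoc, ← mul_div_assoc, one_le_div h0']
  refine h'.trans (le_of_eq ?_)
  push_cast
  ring

/-- The `m`-th Haar moment of a single outcome probability exceeds `N_B ^ (-m)` by a factor of at
most `exp (m ^ 2 / (2 N_A))`. -/
theorem ascFactorial_div_le (nA nB m : ℕ) :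
    ((2 ^ nA : ℕ).ascFactorial m : ℝ) / ((2 ^ nA * 2 ^ nB : ℕ).ascFactorial m : ℝ)
      ≤ Real.exp (m ^ 2 / (2 * (2 : ℝ) ^ nA)) / ((2 : ℝ) ^ nB) ^ m := by
  have h1 := ascFactorial_le_pow_mul_exp (a := 2 ^ nA) (by positivity) m
  have h2 : ((2 : ℝ) ^ nA * (2 : ℝ) ^ nB) ^ m
      ≤ (((2 ^ nA * 2 ^ nB).ascFactorial m : ℕ) : ℝ) := by
    exact_mod_cast pow_le_ascFactorial (2 ^ nA * 2 ^ nB) m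
  push_cast at h1
  calc _ ≤ (((2 : ℝ) ^ nA) ^ m * Real.exp (m ^ 2 / (2 * (2 : ℝ) ^ nA)))
        / ((2 : ℝ) ^ nA * (2 : ℝ) ^ nB) ^ m := by gcongr
    _ = _ := by
      rw [mul_pow]
      field_simp

theorem pow_mul_integral_probMoment_haarState_le (nA nB j : ℕ) :
    ((2 : ℝ) ^ nB) ^ (2 * j) * ∫ Φ, probMoment Φ.1 (2 * j + 1) ∂haarState (Bits nA × Bits nB)
      ≤ Real.exp (2 * ((j : ℝ) + 1) ^ 2 / (2 : ℝ) ^ nA) := by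
  rw [integral_probMoment_haarState, Fintype.card_prod, card_bits, card_bits]
  have h := ascFactorial_div_le nA nB (2 * j + 1)
  push_cast at h ⊢
  calc _ ≤ ((2 : ℝ) ^ nB) ^ (2 * j) * ((2 : ℝ) ^ nB *
        (Real.exp ((2 * (j : ℝ) + 1) ^ 2 / (2 * (2 : ℝ) ^ nA))
          / ((2 : ℝ) ^ nB) ^ (2 * j + 1))) := by
        gcongr
    _ = Real.exp ((2 * (j : ℝ) + 1) ^ 2 / (2 * (2 : ℝ) ^ nA)) := by
        field_simp
        ring
    _ ≤ _ := by
        refine Real.exp_le_exp.2 ?_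
        rw [div_le_div_iff₀ (by positivity) (by positivity)]
        have : (0 : ℝ) < (2 : ℝ) ^ nA := by positivity
        have h1 : (2 * (j : ℝ) + 1) ^ 2 ≤ 4 * ((j : ℝ) + 1) ^ 2 := by
          nlinarith [(Nat.cast_nonneg j : (0 : ℝ) ≤ j)]
        nlinarith

/-- The Haar average of the normalized Frobenius norm is close to its value for a flat ensemble;
the dimension bound on `B` is what makes the diagonal terms negligible. -/
theorem symDim_mul_integral_overlapMoment_haarState_le {nA nB j : ℕ}
    (hB : (j + 2) * nA ≤ nB) :
    symDim (2 ^ nA) (j + 1) * ((2 : ℝ) ^ nB) ^ (2 * j)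
        * ∫ Φ, overlapMoment Φ.1 (j + 1) ∂haarState (Bits nA × Bits nB)
      ≤ Real.exp (2 * ((j : ℝ) + 1) ^ 2 / (2 : ℝ) ^ nA) * (1 + 1 / (2 : ℝ) ^ nA) := by
  set a : ℝ := (2 : ℝ) ^ nA with ha
  set b : ℝ := (2 : ℝ) ^ nB with hb
  set d := symDim (2 ^ nA) (j + 1) with hd
  set E := Real.exp (2 * ((j : ℝ) + 1) ^ 2 / a) with hE
  have ha0 : 0 < a := by positivity
  have hb0 : 0 < b := by positivity
  have hd0 : 0 ≤ d := div_nonneg (by positivity) (by positivity)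
  have hT := integral_overlapMoment_haarState_le nA nB (j + 1)
  rw [Fintype.card_prod, card_bits, card_bits] at hT
  push_cast at hT
  rw [← hb] at hT
  set A1 : ℝ := ((2 ^ nA : ℕ).ascFactorial (j + 1) : ℝ) with hA1
  set A2 : ℝ := ((2 ^ nA : ℕ).ascFactorial (j + 1 + (j + 1)) : ℝ) with hA2
  set N2 : ℝ := ((2 ^ nA * 2 ^ nB : ℕ).ascFactorial (j + 1 + (j + 1)) : ℝ) with hN2
  have hA1le : A1 ≤ a ^ (j + 1) * Real.exp (((j : ℝ) + 1) ^ 2 / (2 * a)) := by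
    have := ascFactorial_le_pow_mul_exp (a := 2 ^ nA) (by positivity) (j + 1)
    push_cast at this
    exact this
  have hN2le : (a * b) ^ (2 * (j + 1)) ≤ N2 := by
    rw [two_mul, ha, hb, hN2]
    exact_mod_cast pow_le_ascFactorial (2 ^ nA * 2 ^ nB) (j + 1 + (j + 1))
  have hdiag : A2 / N2 ≤ E / b ^ (2 * (j + 1)) := by
    have h := ascFactorial_div_le nA nB (j + 1 + (j + 1))
    have e : ((j + 1 + (j + 1) : ℕ) : ℝ) ^ 2 / (2 * (2 : ℝ) ^ nA)
        = 2 * ((j : ℝ) + 1) ^ 2 / a := by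
      push_cast
      field_simp
      ring
    rw [e, ← two_mul] at h
    rw [hA2, hN2, ← two_mul]
    exact h
  -- the dimension bound enters through `d ≤ a ^ k` and `a ^ (k + 1) ≤ b`
  have hda : d * a ≤ b := by
    have h1 : d ≤ a ^ (j + 1) := by
      have := symDim_le_pow (a := 2 ^ nA) (by positivity) (j + 1)
      push_cast at this
      exact this
    calc d * a ≤ a ^ (j + 1) * a := by gcongr
      _ = (2 : ℝ) ^ ((j + 2) * nA) := by rw [ha, ← pow_succ, ← pow_mul, mul_comm]
      _ ≤ b := pow_le_pow_right₀ one_le_two hB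
  have hdk : d * ((j + 1).factorial : ℝ) = A1 := by
    rw [hd, symDim]
    exact div_mul_cancel₀ _ (by exact_mod_cast (j + 1).factorial_ne_zero)
  have hoff : A1 ^ 2 / N2 ≤ E / b ^ (2 * (j + 1)) := by
    have h1 : A1 ^ 2 ≤ (a ^ (j + 1)) ^ 2 * E := by
      calc A1 ^ 2 ≤ (a ^ (j + 1) * Real.exp (((j : ℝ) + 1) ^ 2 / (2 * a))) ^ 2 :=
            pow_le_pow_left₀ (by positivity) hA1le 2
        _ = (a ^ (j + 1)) ^ 2 * Real.exp (((j : ℝ) + 1) ^ 2 / a) := by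
            rw [mul_pow, ← Real.exp_nat_mul]
            congr 2
            push_cast
            field_simp
        _ ≤ _ := by
            rw [hE]
            gcongr
            nlinarith [sq_nonneg ((j : ℝ) + 1)]
    calc A1 ^ 2 / N2 ≤ ((a ^ (j + 1)) ^ 2 * E) / (a * b) ^ (2 * (j + 1)) := by gcongr
      _ = _ := by
        rw [mul_pow, ← pow_mul, mul_comm (j + 1) 2]
        field_simp
  calc _ ≤ d * b ^ (2 * j) * (b * (A2 / N2)
          + b ^ 2 * (((j + 1).factorial : ℝ) * A1 / N2)) := by gcongr
    _ = d * b ^ (2 * j + 1) * (A2 / N2)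
          + b ^ (2 * (j + 1)) * ((d * ((j + 1).factorial : ℝ)) * A1 / N2) := by ring
    _ = d * b ^ (2 * j + 1) * (A2 / N2) + b ^ (2 * (j + 1)) * (A1 ^ 2 / N2) := by
        rw [hdk, sq]
    _ ≤ d * b ^ (2 * j + 1) * (E / b ^ (2 * (j + 1)))
          + b ^ (2 * (j + 1)) * (E / b ^ (2 * (j + 1))) := by gcongr
    _ = E * (d / b) + E := by
        rw [show 2 * (j + 1) = 2 * j + 1 + 1 by ring, pow_succ b (2 * j + 1)]
        field_simp
    _ ≤ E * (1 / a) + E := by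
        have : d / b ≤ 1 / a := by
          rw [div_le_div_iff₀ hb0 ha0]
          linarith
        have hE0 : 0 ≤ E := (Real.exp_pos _).le
        gcongr
    _ = _ := by ring

theorem exp_sub_one_le {x y : ℝ} (hx : 0 ≤ x) (hxy : x ≤ y) :
    Real.exp x - 1 ≤ x * Real.exp y := by
  have h1 := Real.one_sub_le_exp_neg x
  have h2 : Real.exp x * Real.exp (-x) = 1 := by rw [← Real.exp_add, add_neg_cancel, Real.exp_zero]
  have h3 : Real.exp x ≤ Real.exp y := Real.exp_le_exp.2 hxy
  nlinarith [Real.exp_pos x]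

/-- The moment comparison: for an approximate `2k`-design, the average squared distance is of order
`k ^ 2 / N_A`. -/
theorem integral_errBound_le {nA nB j : ℕ} {c ε : ℝ} (hc : 0 < c)
    (hB : (j + 1 + 1) * nA < nB) (hk : ((j : ℝ) + 1) ^ 2 ≤ 4 * (2 : ℝ) ^ nA)
    {μ : Measure (PureState (Bits nA × Bits nB))} [IsProbabilityMeasure μ]
    (hε : ε ≤ c / (((2 : ℝ) ^ nB) ^ (2 * (j + 1)) * (2 : ℝ) ^ nA))
    (hμ : IsApproxStateDesign μ (2 * (j + 1)) ε) :
    ∫ Φ, errBound Φ.1 j ∂μ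
      ≤ (10 * Real.exp 8 + 12 * c) * (((j : ℝ) + 1) ^ 2 / (2 : ℝ) ^ nA) := by
  set a : ℝ := (2 : ℝ) ^ nA with ha
  set b : ℝ := (2 : ℝ) ^ nB with hb
  set d := symDim (2 ^ nA) (j + 1) with hd
  set κ := ((j : ℝ) + 1) ^ 2 with hκ
  set ν := haarState (Bits nA × Bits nB) with hν
  have ha0 : 0 < a := by positivity
  have hb1 : 1 ≤ b := one_le_pow₀ one_le_two
  have hb0 : 0 < b := by positivity
  have hd0 : 0 ≤ d := div_nonneg (by positivity) (by positivity)
  have hκ1 : 1 ≤ κ := one_le_pow₀ (by linarith [(Nat.cast_nonneg j : (0 : ℝ) ≤ j)])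
  have hε0 : 0 ≤ ε := (traceNorm_nonneg _).trans (hμ 0 (Nat.zero_le _))
  have hεb : b ^ (2 * (j + 1)) * ε ≤ c / a := by
    calc b ^ (2 * (j + 1)) * ε ≤ b ^ (2 * (j + 1)) * (c / (b ^ (2 * (j + 1)) * a)) := by gcongr
      _ = c / a := by field_simp
  have hdb : d ≤ b := by
    have h1 := symDim_le_pow (a := 2 ^ nA) (by positivity) (j + 1)
    push_cast at h1
    refine h1.trans ?_
    rw [← pow_mul]
    exact pow_le_pow_right₀ one_le_two (by nlinarith)
  -- the coefficients of `errBound` are at most a constant times `b ^ (2k)`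
  have e1 : b ^ j * ε ≤ c / a := le_trans (by gcongr; omega) hεb
  have e2 : b ^ (2 * j) * ε ≤ c / a := le_trans (by gcongr; omega) hεb
  have e3 : d * b ^ (2 * j) * ε ≤ c / a := by
    refine le_trans ?_ hεb
    calc d * b ^ (2 * j) * ε ≤ b * b ^ (2 * j) * ε := by gcongr
      _ = b ^ (2 * j + 1) * ε := by ring
      _ ≤ _ := by gcongr; omega
  have d1 := abs_le.1 (abs_integral_probMoment_sub_le hμ (m := j + 1) (by omega) (by omega))
  have d2 := abs_le.1 (abs_integral_probMoment_sub_le hμ (m := 2 * j + 1) (by omega) (by omega))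
  have d3 := abs_le.1 (abs_integral_overlapMoment_sub_le hμ (k := j + 1) (by omega) (by omega))
  have h1 := one_le_pow_mul_integral_probMoment_haarState nA nB j
  have h2 := pow_mul_integral_probMoment_haarState_le nA nB j
  have h3 := symDim_mul_integral_overlapMoment_haarState_le (nA := nA) (nB := nB) (j := j)
    (by linarith)
  have i1 := (continuous_probMoment (nA := nA) (nB := nB) (j + 1)).integrable_pureState μ
  have i2 := (continuous_probMoment (nA := nA) (nB := nB) (2 * j + 1)).integrable_pureState μ
  have i3 := (continuous_overlapMoment (nA := nA) (nB := nB) (j + 1)).integrable_pureState μ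
  rw [← hν] at d1 d2 d3 h1 h2 h3
  rw [← hb] at h1 h2 h3
  rw [← ha, ← hκ] at h2 h3
  rw [← hd] at h3
  set S := ∫ Φ, probMoment Φ.1 (j + 1) ∂μ with hS
  set S2 := ∫ Φ, probMoment Φ.1 (2 * j + 1) ∂μ with hS2
  set T := ∫ Φ, overlapMoment Φ.1 (j + 1) ∂μ with hT
  have hint : ∫ Φ, errBound Φ.1 j ∂μ = 2 * ((1 - 2 * b ^ j * S + b ^ (2 * j) * S2)
      + (d * b ^ (2 * j) * T - 2 * b ^ j * S + 1)) := by
    have j1 := i1.const_mul (-(8 * b ^ j))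
    have j2 := i2.const_mul (2 * b ^ (2 * j))
    have j3 := i3.const_mul (2 * (d * b ^ (2 * j)))
    have k0 : Integrable (fun _ : PureState (Bits nA × Bits nB) => (4 : ℝ)) μ :=
      integrable_const 4
    have k1 : Integrable (fun Φ : PureState (Bits nA × Bits nB) =>
        4 + -(8 * b ^ j) * probMoment Φ.1 (j + 1)) μ := k0.add j1
    have k2 : Integrable (fun Φ : PureState (Bits nA × Bits nB) =>
        4 + -(8 * b ^ j) * probMoment Φ.1 (j + 1)
          + 2 * b ^ (2 * j) * probMoment Φ.1 (2 * j + 1)) μ := k1.add j2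
    have hexp : ∀ Φ : PureState (Bits nA × Bits nB), errBound Φ.1 j
        = 4 + -(8 * b ^ j) * probMoment Φ.1 (j + 1) + 2 * b ^ (2 * j) * probMoment Φ.1 (2 * j + 1)
          + 2 * (d * b ^ (2 * j)) * overlapMoment Φ.1 (j + 1) := fun Φ => by
      rw [errBound, ← hb, ← hd]
      ring
    simp only [hexp]
    rw [integral_add k2 j3, integral_add k1 j2, integral_add k0 j1, integral_const_mul,
      integral_const_mul, integral_const_mul, integral_const, probReal_univ, one_smul]
    ring
  have f1 : 1 - c / a ≤ b ^ j * S := by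
    have := mul_le_mul_of_nonneg_left d1.1 (pow_nonneg hb0.le j)
    linarith
  have f2 : b ^ (2 * j) * S2 ≤ Real.exp (2 * κ / a) + c / a := by
    have := mul_le_mul_of_nonneg_left d2.2 (pow_nonneg hb0.le (2 * j))
    linarith
  have f3 : d * b ^ (2 * j) * T ≤ Real.exp (2 * κ / a) * (1 + 1 / a) + c / a := by
    have := mul_le_mul_of_nonneg_left d3.2 (mul_nonneg hd0 (pow_nonneg hb0.le (2 * j)))
    linarith
  have hx8 : 2 * κ / a ≤ 8 := by
    rw [div_le_iff₀ ha0]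
    linarith
  have g1 := exp_sub_one_le (by positivity : 0 ≤ 2 * κ / a) hx8
  have g2 : Real.exp (2 * κ / a) ≤ Real.exp 8 := Real.exp_le_exp.2 hx8
  have g3 : 1 / a ≤ κ / a := by gcongr
  have g4 : Real.exp (2 * κ / a) * (1 / a) ≤ Real.exp 8 * (κ / a) := by gcongr
  have g5 : c / a ≤ c * (κ / a) := by
    rw [div_eq_mul_one_div]
    gcongr
  have g6 : 2 * κ / a * Real.exp 8 = 2 * (Real.exp 8 * (κ / a)) := by ring
  rw [hint]
  linarith

/-- Unless `k` is so large that the claimed bound is trivial, Markov's inequality applies to the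
squared distance. -/
theorem le_measureReal_traceNorm_lt {nA nB k : ℕ} {α c ε : ℝ} (hc : 0 < c) (hα : α < 1 / 2)
    (hk : 1 ≤ k) (hB : (k + 1) * nA < nB)
    {μ : Measure (PureState (Bits nA × Bits nB))} [IsProbabilityMeasure μ]
    (hε : ε ≤ c / (((2 : ℝ) ^ nB) ^ (2 * k) * (2 : ℝ) ^ nA))
    (hμ : IsApproxStateDesign μ (2 * k) ε) :
    1 - (10 * Real.exp 8 + 12 * c) / ((2 : ℝ) ^ nA) ^ (1 / 2 - α) ≤
      μ.real {Φ | traceNorm (projectedMoment Φ.1 k - moment (haarState (Bits nA)) k)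
        < (k : ℝ) / ((2 : ℝ) ^ nA) ^ α} := by
  obtain ⟨j, rfl⟩ : ∃ j, k = j + 1 := ⟨k - 1, by omega⟩
  set K := 10 * Real.exp 8 + 12 * c with hK
  have hK0 : 0 < K := by positivity
  set a : ℝ := (2 : ℝ) ^ nA with ha
  have ha0 : 0 < a := by positivity
  have ha1 : 1 ≤ a := one_le_pow₀ one_le_two
  set G := {Φ : PureState (Bits nA × Bits nB) |
    traceNorm (projectedMoment Φ.1 (j + 1) - moment (haarState (Bits nA)) (j + 1))
      < ((j + 1 : ℕ) : ℝ) / a ^ α} with hG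
  by_cases hbig : 2 * a ^ α < ((j + 1 : ℕ) : ℝ)
  · have hG1 : G = Set.univ := by
      refine Set.eq_univ_of_forall fun Φ => ?_
      change traceNorm _ < _
      have h1 := traceNorm_sub_le (projectedMoment Φ.1 (j + 1))
        (moment (haarState (Bits nA)) (j + 1))
      have h2 := traceNorm_projectedMoment_le (norm_eq_of_mem_sphere Φ) (j + 1)
      have h3 := traceNorm_moment_haarState_le (Bits nA) (j + 1)
      have h4 : 2 < ((j + 1 : ℕ) : ℝ) / a ^ α := by
        rwa [lt_div_iff₀ (Real.rpow_pos_of_pos ha0 α)]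
      linarith
    rw [hG1, probReal_univ]
    have : 0 ≤ K / a ^ (1 / 2 - α) := by positivity
    linarith
  · push Not at hbig
    push_cast at hbig
    have haα0 : 0 < a ^ α := Real.rpow_pos_of_pos ha0 α
    have hsq : (a ^ α) ^ 2 = a ^ (2 * α) := by
      rw [← Real.rpow_natCast, ← Real.rpow_mul ha0.le]
      congr 1
      push_cast
      ring
    have hk4 : ((j : ℝ) + 1) ^ 2 ≤ 4 * a := by
      have h1 : ((j : ℝ) + 1) ^ 2 ≤ (2 * a ^ α) ^ 2 := pow_le_pow_left₀ (by positivity) hbig 2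
      have h2 : a ^ (2 * α) ≤ a := by
        calc a ^ (2 * α) ≤ a ^ (1 : ℝ) := Real.rpow_le_rpow_of_exponent_le ha1 (by linarith)
          _ = a := Real.rpow_one a
      rw [mul_pow, hsq] at h1
      linarith
    have hW := integral_errBound_le hc hB hk4 hε hμ
    have hnn : ∀ Φ : PureState (Bits nA × Bits nB), 0 ≤ errBound Φ.1 j := fun Φ =>
      (sq_nonneg _).trans (sq_traceNorm_le_errBound (norm_eq_of_mem_sphere Φ) j)
    -- the square of the claimed accuracy
    set θ := (((j : ℝ) + 1) / a ^ α) ^ 2 with hθ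
    have hθ0 : 0 < θ := by positivity
    have hmarkov := mul_meas_ge_le_integral_of_nonneg (Filter.Eventually.of_forall hnn)
      ((continuous_errBound (nA := nA) (nB := nB) j).integrable_pureState μ) θ
    set Bad := {Φ : PureState (Bits nA × Bits nB) | θ ≤ errBound Φ.1 j} with hBad
    have hmeas : MeasurableSet Bad :=
      (isClosed_le continuous_const (continuous_errBound j)).measurableSet
    have hsub : Badᶜ ⊆ G := by
      intro Φ hΦ
      have h1 : errBound Φ.1 j < θ := not_le.1 hΦ
      have h2 := (sq_traceNorm_le_errBound (norm_eq_of_mem_sphere Φ) j).trans_lt h1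
      have h3 := lt_of_pow_lt_pow_left₀ 2 (by positivity) h2
      change traceNorm _ < _
      push_cast
      exact h3
    have hbound : μ.real Bad ≤ K / a ^ (1 / 2 - α) := by
      have h1 : μ.real Bad ≤ K * (((j : ℝ) + 1) ^ 2 / a) / θ := by
        rw [le_div_iff₀ hθ0, mul_comm]
        exact hmarkov.trans hW
      refine h1.trans ?_
      have h2 : K * (((j : ℝ) + 1) ^ 2 / a) / θ = K * ((a ^ α) ^ 2 / a) := by
        rw [hθ]
        field_simp
      have h3 : (a ^ α) ^ 2 / a = a ^ (2 * α - 1) := by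
        rw [hsq, Real.rpow_sub ha0, Real.rpow_one]
      rw [h2, h3, div_eq_mul_inv, ← Real.rpow_neg ha0.le]
      gcongr
      linarith
    have hcompl := probReal_compl_eq_one_sub (μ := μ) hmeas
    have hmono : μ.real Badᶜ ≤ μ.real G := measureReal_mono hsub
    linarith

/-- A power of `n` times `2 ^ (-n / 8)` is bounded. -/
theorem exists_pow_mul_two_rpow_le (d : ℕ) :
    ∃ M : ℝ, ∀ n : ℕ, (n : ℝ) ^ d * (2 : ℝ) ^ (-((1 / 8 : ℝ) * n)) ≤ M := by
  have hr : (2 : ℝ) ^ (-(1 / 8 : ℝ)) < 1 :=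
    Real.rpow_lt_one_of_one_lt_of_neg one_lt_two (by norm_num)
  have h := tendsto_pow_const_mul_const_pow_of_lt_one d (by positivity) hr
  obtain ⟨M, hM⟩ := h.bddAbove_range
  refine ⟨M, fun n => ?_⟩
  have : (n : ℝ) ^ d * ((2 : ℝ) ^ (-(1 / 8 : ℝ))) ^ n ≤ M := hM ⟨n, rfl⟩
  rwa [← Real.rpow_natCast ((2 : ℝ) ^ (-(1 / 8 : ℝ))), ← Real.rpow_mul (by norm_num), neg_mul]
    at this

end Concentration

end ProjectedDesign

end

theorem mainTheorem2 :
    ∀ c : ℝ, 0 < c →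
      (∃ C : ℝ, 0 < C ∧
        ∀ (α : ℝ) (k nA nB : ℕ), 0 < α → α < 1 / 2 → 1 ≤ k → (k + 1) * nA < nB →
        ∀ (μ : Measure
            (ProjectedDesign.PureState (ProjectedDesign.Bits nA × ProjectedDesign.Bits nB)))
          [IsProbabilityMeasure μ] (ε' : ℝ),
          ε' ≤ c / (((2 : ℝ) ^ nB) ^ (2 * k) * (2 : ℝ) ^ nA) →
          ProjectedDesign.IsApproxStateDesign μ (2 * k) ε' →
          1 - C / ((2 : ℝ) ^ nA) ^ (1 / 2 - α) ≤
            μ.real {Φ | ∃ ε : ℝ, ε < (k : ℝ) / ((2 : ℝ) ^ nA) ^ α ∧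
              ProjectedDesign.IsApproxProjectedDesign Φ.1 k ε}) ∧
      (∀ (D : ℝ) (d : ℕ), ∃ C γ : ℝ, 0 < C ∧ 0 < γ ∧
        ∀ (k nA nB : ℕ), 1 ≤ k → (k : ℝ) ≤ D * (nA : ℝ) ^ d → (k + 1) * nA < nB →
        ∀ (μ : Measure
            (ProjectedDesign.PureState (ProjectedDesign.Bits nA × ProjectedDesign.Bits nB)))
          [IsProbabilityMeasure μ] (ε' : ℝ),
          ε' ≤ c / (((2 : ℝ) ^ nB) ^ (2 * k) * (2 : ℝ) ^ nA) →
          ProjectedDesign.IsApproxStateDesign μ (2 * k) ε' →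
          1 - C * (2 : ℝ) ^ (-(γ * nA)) ≤
            μ.real {Φ | ProjectedDesign.IsApproxProjectedDesign Φ.1 k
              (C * (2 : ℝ) ^ (-(γ * nA)))}) := by
  intro c hc
  have hK0 : 0 < 10 * Real.exp 8 + 12 * c := by positivity
  refine ⟨⟨10 * Real.exp 8 + 12 * c, hK0, ?_⟩, ?_⟩
  · intro α k nA nB _ hα hk hB μ _ ε' hε hμ
    refine (ProjectedDesign.le_measureReal_traceNorm_lt hc hα hk hB hε hμ).trans ?_
    exact measureReal_mono fun Φ hΦ => ⟨_, hΦ, le_refl _⟩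
  · intro D d
    obtain ⟨M, hM⟩ := ProjectedDesign.exists_pow_mul_two_rpow_le d
    refine ⟨max (10 * Real.exp 8 + 12 * c) (|D| * M), 1 / 8, lt_max_of_lt_left hK0, by norm_num, ?_⟩
    intro k nA nB hk hkD hB μ _ ε' hε hμ
    set C := max (10 * Real.exp 8 + 12 * c) (|D| * M) with hC
    -- with `α = 1 / 4` both error terms are `2 ^ (-nA / 4)`, up to the polynomial factor `k`
    have h := ProjectedDesign.le_measureReal_traceNorm_lt (α := 1 / 4) hc (by norm_num)
      hk hB hε hμ
    have hpow : ((2 : ℝ) ^ nA) ^ (1 / 4 : ℝ) = (2 : ℝ) ^ ((1 / 4 : ℝ) * nA) := by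
      rw [← Real.rpow_natCast, ← Real.rpow_mul (by norm_num), mul_comm]
    have h8 : ∀ x : ℝ, x / ((2 : ℝ) ^ nA) ^ (1 / 4 : ℝ) = x * (2 : ℝ) ^ (-((1 / 4 : ℝ) * nA)) :=
      fun x => by rw [hpow, div_eq_mul_inv, ← Real.rpow_neg (by norm_num)]
    have hsplit : (2 : ℝ) ^ (-((1 / 4 : ℝ) * nA))
        = (2 : ℝ) ^ (-((1 / 8 : ℝ) * nA)) * (2 : ℝ) ^ (-((1 / 8 : ℝ) * nA)) := by
      rw [← Real.rpow_add (by norm_num)]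
      congr 1
      ring
    have hu0 : 0 < (2 : ℝ) ^ (-((1 / 8 : ℝ) * nA)) := Real.rpow_pos_of_pos two_pos _
    have hu1 : (2 : ℝ) ^ (-((1 / 8 : ℝ) * nA)) ≤ 1 :=
      Real.rpow_le_one_of_one_le_of_nonpos one_le_two (by
        linarith [(Nat.cast_nonneg nA : (0 : ℝ) ≤ nA)])
    rw [show (1 / 2 - 1 / 4 : ℝ) = 1 / 4 by norm_num, h8, hsplit] at h
    set u := (2 : ℝ) ^ (-((1 / 8 : ℝ) * nA)) with hu
    refine le_trans ?_ (h.trans (measureReal_mono fun Φ hΦ => ?_))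
    · have h1 : (10 * Real.exp 8 + 12 * c) * (u * u) ≤ C * u := by
        refine mul_le_mul (le_max_left _ _) (mul_le_of_le_one_left hu0.le hu1) (by positivity) ?_
        exact hK0.le.trans (le_max_left _ _)
      linarith
    · have hΦ' := le_of_lt (Set.mem_ofPred_eq ▸ hΦ : _ < _)
      refine hΦ'.trans ?_
      rw [h8, hsplit, ← mul_assoc]
      refine mul_le_mul_of_nonneg_right ?_ hu0.le
      calc (k : ℝ) * u ≤ (|D| * (nA : ℝ) ^ d) * u := by
            gcongr
            exact hkD.trans (by gcongr; exact le_abs_self D)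
        _ = |D| * ((nA : ℝ) ^ d * u) := by ring
        _ ≤ |D| * M := by gcongr; exact hM nA
        _ ≤ C := le_max_right _ _
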